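/- Let $(N,g)$ be a smooth (Hausdorff) Riemannian manifold without boundary, of dimension $n\ge 1$ and not necessarily complete. For $x\in N$ let $\mathcal E_x\subseteq T_xN$ be the set of those $v$ for which the geodesic $\gamma_v$ of the Levi-Civita connection with $\gamma_v(0)=x$ and $\dot\gamma_v(0)=v$ is defined on an open interval containing $[0,1]$, and let $\exp_x\colon\mathcal E_x\to N$, $\exp_x(v)=\gamma_v(1)$, be the geodesic exponential map at $x$. Then for every $x\in N$ the set $\mathcal E_x$ is open in $T_xN$ and, for every $v\in\mathcal E_x$, the map $\exp_x$ is differentiable at $v$ and the kernel of its differential $$\mathrm d(\exp_x)_v\colon T_v(T_xN)\cong T_xN\to T_{\exp_x(v)}N$$ satisfies $$\dim\ker \mathrm d(\exp_x)_v<n .$$ -/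

import Mathlib

open scoped Manifold ContDiff Topology

noncomputable section

namespace RiemannianExp

variable {E : Type*} [NormedAddCommGroup E] [NormedSpace ℝ E]
  {M : Type*} [TopologicalSpace M] [ChartedSpace E M] [IsManifold 𝓘(ℝ, E) ∞ M]

/-- A smooth Riemannian metric on the (boundaryless) smooth manifold `M` modelled on `E`. -/
abbrev Metric (E : Type*) [NormedAddCommGroup E] [NormedSpace ℝ E]
    (M : Type*) [TopologicalSpace M] [ChartedSpace E M] [IsManifold 𝓘(ℝ, E) ∞ M] :=
  Bundle.ContMDiffRiemannianMetric 𝓘(ℝ, E) ∞ E (fun x : M ↦ TangentSpace 𝓘(ℝ, E) x)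

/-- The coordinate expression `p ↦ (g_{ij}(p))` of the metric in the preferred chart at `y`: the
pullback of `g` under the inverse of the chart. It is meaningful for `p` in the chart's target. -/
def localMetric (g : Metric E M) (y : M) (p : E) : E →L[ℝ] E →L[ℝ] ℝ :=
  let A : E →L[ℝ] E := mfderiv 𝓘(ℝ, E) 𝓘(ℝ, E) (extChartAt 𝓘(ℝ, E) y).symm p
  let B : E →L[ℝ] E →L[ℝ] ℝ := g.inner ((extChartAt 𝓘(ℝ, E) y).symm p)
  B.bilinearComp A A

/-- The Christoffel symbols of the first kind of the Levi-Civita connection in the chart at `y`,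
`Γ(u, v; w) = ½ (∂_u g(v, w) + ∂_v g(u, w) - ∂_w g(u, v))`; in terms of the usual symbols,
`Γ(u, v; w) = g (Γᵏ_{ij} uⁱ vʲ ∂_k, w)`. -/
def christoffel (g : Metric E M) (y : M) (p u v w : E) : ℝ :=
  (1 / 2 : ℝ) * (fderiv ℝ (localMetric g y) p u v w + fderiv ℝ (localMetric g y) p v u w
    - fderiv ℝ (localMetric g y) p w u v)

/-- `γ` is a geodesic of `g` on the open set `s` of times: it is `C²` there and, in every preferred
chart that contains `γ t`, its coordinate expression `c` satisfies the geodesic equation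
`c'' + Γ(c', c') = 0`, written with the free index lowered by `g`. -/
structure IsGeodesicOn (g : Metric E M) (γ : ℝ → M) (s : Set ℝ) : Prop where
  contMDiffOn : ContMDiffOn 𝓘(ℝ, ℝ) 𝓘(ℝ, E) 2 γ s
  equation : ∀ t ∈ s, ∀ y : M, γ t ∈ (chartAt E y).source →
    let c : ℝ → E := fun τ ↦ extChartAt 𝓘(ℝ, E) y (γ τ)
    ∀ w : E, localMetric g y (c t) (deriv (deriv c) t) w
      + christoffel g y (c t) (deriv c t) (deriv c t) w = 0

/-- `γ` is a geodesic on an open interval that contains `[0, 1]`, with `γ 0 = x` and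
`γ' 0 = v`. -/
def IsUnitGeodesicFrom (g : Metric E M) (x : M) (v : TangentSpace 𝓘(ℝ, E) x) (γ : ℝ → M) : Prop :=
  ∃ a b : ℝ, a < 0 ∧ 1 < b ∧ IsGeodesicOn g γ (Set.Ioo a b) ∧
    tangentMap 𝓘(ℝ, ℝ) 𝓘(ℝ, E) γ ⟨0, (1 : ℝ)⟩ = (⟨x, v⟩ : TangentBundle 𝓘(ℝ, E) M)

/-- The domain in `T_x M` of the exponential map at `x`: the initial velocities of geodesics that
start at `x` and exist up to time `1`. -/
def expDomain (g : Metric E M) (x : M) : Set (TangentSpace 𝓘(ℝ, E) x) :=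
  {v | ∃ γ : ℝ → M, IsUnitGeodesicFrom g x v γ}

open Classical in
/-- The exponential map `exp_x`, sending `v` to `γ 1` for the geodesic `γ` with `γ 0 = x` and
`γ' 0 = v` (on a Hausdorff manifold, `γ 1` does not depend on the choice of `γ`). Outside
`expDomain g x` the value is the dummy `x`. -/
def expMap (g : Metric E M) (x : M) (v : TangentSpace 𝓘(ℝ, E) x) : M :=
  if h : ∃ γ : ℝ → M, IsUnitGeodesicFrom g x v γ then h.choose 1 else x

end RiemannianExp

end

/-! The kernel is a proper subspace as soon as the differential does not kill some vector, and the
radial direction supplies one. Homogeneity gives exp_x(sv) = γ_v(s) (`expMap_smul_eq`), so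
d(exp_x)_{sv} sends v to γ_v'(s). If that velocity vanished, γ_v would agree with a constant
geodesic by uniqueness (`eqOn_of_state_eq`, where the Hausdorff property enters), forcing v = 0. For
v ≠ 0 take s = 1; at the origin take s = 0 on the ray through any nonzero vector of the domain.

The analytic half is that the domain is open and exp_x is differentiable on it. In a chart,
geodesics are projections of integral curves of a smooth spray, whose local flow is differentiable
in the initial state (`ContDiffAt.exists_localFlow_differentiableAt`). A connectedness argument
along the given geodesic over [0, 1] chains these local flows (`HasGeodesicFamily.extend`,
`IsGeodesicFrom.hasGeodesicFamily_one`) into a family of geodesics that outlives time 1 for all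
nearby velocities. Passing between charts rests on the transformation law
`christoffel_eq_transition`. -/

/-! ### Differentiable dependence of ODE solutions on initial data -/

open Metric Set in
/-- A `C²` map satisfies a uniform quadratic Taylor estimate near a point. -/
theorem ContDiffAt.exists_ball_norm_sub_sub_fderiv_le {F G : Type*} [NormedAddCommGroup F]
    [NormedSpace ℝ F] [NormedAddCommGroup G] [NormedSpace ℝ G] {f : F → G} {z₀ : F}
    (hf : ContDiffAt ℝ 2 f z₀) :
    ∃ ρ > 0, ∃ K C : ℝ, ∀ a ∈ ball z₀ ρ, ‖fderiv ℝ f a‖ ≤ K ∧ ∀ b ∈ ball z₀ ρ,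
      ‖f b - f a - fderiv ℝ f a (b - a)‖ ≤ C * ‖b - a‖ ^ 2 := by
  have hf' : ContDiffAt ℝ 1 (fderiv ℝ f) z₀ := hf.fderiv_right (by norm_num)
  obtain ⟨C, s, hs, hC⟩ := hf'.exists_lipschitzOnWith
  have hd : ∀ᶠ z in 𝓝 z₀, DifferentiableAt ℝ f z := by
    filter_upwards [hf.eventually (by simp)] with z hz using hz.differentiableAt (by norm_num)
  have hb : ∀ᶠ z in 𝓝 z₀, ‖fderiv ℝ f z‖ < ‖fderiv ℝ f z₀‖ + 1 :=
    hf'.continuousAt.norm.eventually_lt_const (by linarith)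
  obtain ⟨ρ, hρ, h⟩ := Metric.eventually_nhds_iff_ball.1
    (hd.and (hb.and (Filter.eventually_mem_set.2 hs)))
  refine ⟨ρ, hρ, ‖fderiv ℝ f z₀‖ + 1, C, fun a ha ↦ ⟨(h a ha).2.1.le, fun b hb ↦ ?_⟩⟩
  have hseg : segment ℝ a b ⊆ ball z₀ ρ := (convex_ball z₀ ρ).segment_subset ha hb
  have := (convex_segment a b).norm_image_sub_le_of_norm_hasFDerivWithin_le' (f := f)
    (φ := fderiv ℝ f a) (C := C * ‖b - a‖)
    (fun z hz ↦ (h z (hseg hz)).1.hasFDerivAt.hasFDerivWithinAt) (fun z hz ↦ ?_)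
    (left_mem_segment ℝ a b) (right_mem_segment ℝ a b)
  · simpa [pow_two, mul_assoc] using this
  · refine (hC.norm_sub_le (h z (hseg hz)).2.2 (h a ha).2.2).trans ?_
    gcongr
    exact norm_sub_le_of_mem_segment hz

open Metric Set in
/-- A `C²` vector field has a local flow which is differentiable with respect to the initial
condition at nonnegative times. -/
theorem ContDiffAt.exists_localFlow_differentiableAt {F : Type*} [NormedAddCommGroup F]
    [NormedSpace ℝ F] [CompleteSpace F] {f : F → F} {z₀ : F} (hf : ContDiffAt ℝ 2 f z₀)
    {s : Set F} (hs : s ∈ 𝓝 z₀) :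
    ∃ r > 0, ∃ ε > 0, ∃ Φ : F → ℝ → F, ∀ z ∈ ball z₀ r, Φ z 0 = z ∧
      (∀ t ∈ Ioo (-ε) ε, Φ z t ∈ s ∧ HasDerivAt (Φ z) (f (Φ z t)) t) ∧
      ∀ t ∈ Ico 0 ε, DifferentiableAt ℝ (fun y ↦ Φ y t) z := by
  -- the flow of `f` together with its first variation
  let fHat : F × (F →L[ℝ] F) → F × (F →L[ℝ] F) := fun q ↦ (f q.1, (fderiv ℝ f q.1).comp q.2)
  -- One derivative is lost to the variational equation, so `f` of class `C²` leaves `fHat` of class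
  -- `C¹`, enough for Picard–Lindelöf.
  have hfHat : ContDiffAt ℝ 1 fHat (z₀, ContinuousLinearMap.id ℝ F) := by
    refine ContDiffAt.prodMk ?_ (ContDiffAt.clm_comp ?_ contDiffAt_snd)
    · exact ContDiffAt.comp (z₀, ContinuousLinearMap.id ℝ F) (hf.of_le (by norm_num)) contDiffAt_fst
    · exact ContDiffAt.comp (z₀, ContinuousLinearMap.id ℝ F)
        (hf.fderiv_right (m := 1) (by norm_num)) contDiffAt_fst
  obtain ⟨ρ, hρ, K, C, hKC⟩ := hf.exists_ball_norm_sub_sub_fderiv_le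
  obtain ⟨ε₁, hε₁, A, R, L, K', hR, hpl⟩ := IsPicardLindelof.of_contDiffAt_one hfHat
  obtain ⟨α, hα, L', hL'⟩ :=
    (hpl 0).exists_forall_mem_closedBall_eq_hasDerivWithinAt_lipschitzOnWith
  simp only [zero_sub, zero_add] at hα hL'
  have hαc : ContinuousOn (Function.uncurry α)
      (closedBall (z₀, ContinuousLinearMap.id ℝ F) R ×ˢ Icc (-ε₁) ε₁) :=
    continuousOn_prod_of_continuousOn_lipschitzOnWith _ L'
      (fun x hx ↦ HasDerivWithinAt.continuousOn (hα x hx).2) hL'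
  let ι : F → F × (F →L[ℝ] F) := fun z ↦ (z, ContinuousLinearMap.id ℝ F)
  have hι : ∀ z ∈ closedBall z₀ (R : ℝ), ι z ∈ closedBall (ι z₀) R := by
    intro z hz
    simpa [ι, Prod.dist_eq] using hz
  let Φ : F → ℝ → F := fun z t ↦ (α (ι z) t).1
  have hΦ0 : ∀ z ∈ closedBall z₀ (R : ℝ), Φ z 0 = z := fun z hz ↦ by
    simp only [Φ, (hα _ (hι z hz)).1]; rfl
  have hder : ∀ z ∈ closedBall z₀ (R : ℝ), ∀ t ∈ Ioo (-ε₁) ε₁,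
      HasDerivAt (α (ι z)) (fHat (α (ι z) t)) t := fun z hz t ht ↦
    ((hα _ (hι z hz)).2 t (Ioo_subset_Icc_self ht)).hasDerivAt (Icc_mem_nhds ht.1 ht.2)
  have hderΦ : ∀ z ∈ closedBall z₀ (R : ℝ), ∀ t ∈ Ioo (-ε₁) ε₁,
      HasDerivAt (Φ z) (f (Φ z t)) t := fun z hz t ht ↦ (hder z hz t ht).fst
  have hΦc : ContinuousAt (Function.uncurry Φ) (z₀, 0) := by
    have h1 : ContinuousAt (Function.uncurry α) (ι z₀, 0) :=
      hαc.continuousAt (prod_mem_nhds (closedBall_mem_nhds _ (by exact_mod_cast hR))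
        (Icc_mem_nhds (by linarith) hε₁))
    have h2 : ContinuousAt (fun q : F × ℝ ↦ (ι q.1, q.2)) (z₀, 0) := by
      fun_prop
    exact (ContinuousAt.comp (f := fun q : F × ℝ ↦ (ι q.1, q.2)) (x := (z₀, (0 : ℝ))) h1 h2).fst
  have hev : ∀ᶠ q in 𝓝 (z₀, (0 : ℝ)), Function.uncurry Φ q ∈ s ∩ ball z₀ ρ := by
    apply hΦc.eventually_mem
    rw [Function.uncurry_apply_pair, hΦ0 z₀ (mem_closedBall_self (by positivity))]
    exact Filter.inter_mem hs (ball_mem_nhds _ hρ)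
  obtain ⟨δ, hδ, hball⟩ := Metric.eventually_nhds_iff_ball.1 hev
  have hmem : ∀ z ∈ ball z₀ δ, ∀ t ∈ Ioo (-δ) δ, Φ z t ∈ s ∩ ball z₀ ρ := by
    intro z hz t ht
    refine hball (z, t) ?_
    rw [mem_ball, Prod.dist_eq, max_lt_iff]
    exact ⟨hz, by simpa [abs_lt] using ht⟩
  have hRδ : 0 < min δ R := lt_min hδ (by exact_mod_cast hR)
  refine ⟨min δ R, hRδ, min δ ε₁, lt_min hδ hε₁, Φ, fun z hz ↦ ?_⟩
  have hzδ : ∀ {y}, y ∈ ball z₀ (min δ R) → y ∈ ball z₀ δ :=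
    fun hy ↦ ball_subset_ball (min_le_left _ _) hy
  have hzR : ∀ {y}, y ∈ ball z₀ (min δ R) → y ∈ closedBall z₀ (R : ℝ) :=
    fun hy ↦ ball_subset_closedBall (ball_subset_ball (min_le_right _ _) hy)
  refine ⟨hΦ0 z (hzR hz), fun t ht ↦ ?_, fun t ht ↦ ?_⟩
  · have h1 : t ∈ Ioo (-δ) δ := ⟨by linarith [ht.1, min_le_left δ ε₁],
      ht.2.trans_le (min_le_left _ _)⟩
    have h2 : t ∈ Ioo (-ε₁) ε₁ := ⟨by linarith [ht.1, min_le_right δ ε₁],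
      ht.2.trans_le (min_le_right _ _)⟩
    exact ⟨(hmem z (hzδ hz) t h1).1, hderΦ z (hzR hz) t h2⟩
  · let X : ℝ → F →L[ℝ] F := fun τ ↦ (α (ι z) τ).2
    have hI : ∀ τ ∈ Icc 0 t, τ ∈ Ioo (-δ) δ ∧ τ ∈ Ioo (-ε₁) ε₁ := fun τ hτ ↦
      ⟨⟨by linarith [hτ.1], by linarith [hτ.2, ht.2, min_le_left δ ε₁]⟩,
       ⟨by linarith [hτ.1], by linarith [hτ.2, ht.2, min_le_right δ ε₁]⟩⟩
    have hX : ∀ τ ∈ Icc 0 t, HasDerivAt X ((fderiv ℝ f (Φ z τ)).comp (X τ)) τ :=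
      fun τ hτ ↦ (hder z (hzR hz) τ (hI τ hτ).2).snd
    -- `X` solves the linearised equation with `X 0 = id`. The error `r` starts at zero and
    -- satisfies a linear differential inequality whose source term is quadratic in `y - z`;
    -- Grönwall keeps it quadratic.
    have key : ∀ y ∈ ball z₀ (min δ R), ‖Φ y t - Φ z t - X t (y - z)‖ ≤
        gronwallBound 0 K 1 t * (|C| * L' ^ 2 * ‖y - z‖ ^ 2) := by
      intro y hy
      let r : ℝ → F := fun τ ↦ Φ y τ - Φ z τ - X τ (y - z)
      let r' : ℝ → F := fun τ ↦ f (Φ y τ) - f (Φ z τ) - fderiv ℝ f (Φ z τ) (X τ (y - z))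
      have hr : ∀ τ ∈ Icc 0 t, HasDerivAt r (r' τ) τ := fun τ hτ ↦ by
        have h1 := ((hX τ hτ).clm_apply (hasDerivAt_const τ (y - z)))
        simp only [map_zero, add_zero, ContinuousLinearMap.comp_apply] at h1
        exact ((hderΦ y (hzR hy) τ (hI τ hτ).2).sub (hderΦ z (hzR hz) τ (hI τ hτ).2)).sub h1
      have hbound : ∀ τ ∈ Ico 0 t, ‖r' τ‖ ≤ K * ‖r τ‖ + |C| * L' ^ 2 * ‖y - z‖ ^ 2 := by
        intro τ hτ
        have hτ' := Ico_subset_Icc_self hτ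
        have hzm := (hmem z (hzδ hz) τ (hI τ hτ').1).2
        have hym := (hmem y (hzδ hy) τ (hI τ hτ').1).2
        have hlip : ‖Φ y τ - Φ z τ‖ ≤ L' * ‖y - z‖ := by
          have h1 := (hL' τ (Ioo_subset_Icc_self (hI τ hτ').2)).norm_sub_le
            (hι y (hzR hy)) (hι z (hzR hz))
          have h2 : ‖ι y - ι z‖ = ‖y - z‖ := by simp [ι, Prod.norm_def]
          rw [h2] at h1
          exact (norm_fst_le (α (ι y) τ - α (ι z) τ)).trans h1
        have hsplit : r' τ = fderiv ℝ f (Φ z τ) (r τ) +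
            (f (Φ y τ) - f (Φ z τ) - fderiv ℝ f (Φ z τ) (Φ y τ - Φ z τ)) := by
          simp only [r, r', map_sub]; abel
        rw [hsplit]
        refine (norm_add_le _ _).trans (add_le_add ?_ ?_)
        · refine (ContinuousLinearMap.le_opNorm _ _).trans ?_
          gcongr
          exact (hKC _ hzm).1
        · refine ((hKC _ hzm).2 _ hym).trans ?_
          calc C * ‖Φ y τ - Φ z τ‖ ^ 2 ≤ |C| * (L' * ‖y - z‖) ^ 2 := by
                gcongr
                exact le_abs_self C
            _ = |C| * L' ^ 2 * ‖y - z‖ ^ 2 := by ring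
      have h0 : ‖r 0‖ ≤ 0 := by
        have : X 0 = ContinuousLinearMap.id ℝ F := by
          simp only [X, (hα _ (hι z (hzR hz))).1]; rfl
        simp [r, this, hΦ0 y (hzR hy), hΦ0 z (hzR hz)]
      have := norm_le_gronwallBound_of_norm_deriv_right_le
        (fun τ hτ ↦ (hr τ hτ).continuousAt.continuousWithinAt)
        (fun τ hτ ↦ (hr τ (Ico_subset_Icc_self hτ)).hasDerivWithinAt) h0 hbound t
        (right_mem_Icc.2 ht.1)
      refine this.trans (le_of_eq ?_)
      rw [sub_zero]
      -- With zero initial value the Grönwall bound is linear in its source term, both for `K = 0`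
      -- and for `K ≠ 0`.
      unfold gronwallBound
      split_ifs <;> simp <;> ring
    refine HasFDerivAt.differentiableAt (f' := X t) ?_
    refine HasFDerivAt.of_isLittleO ?_
    refine Asymptotics.IsBigO.trans_isLittleO (g := fun y ↦ ‖y - z‖ ^ 2) ?_ ?_
    · refine Asymptotics.IsBigO.of_bound (|gronwallBound 0 K 1 t| * (|C| * L' ^ 2)) ?_
      filter_upwards [isOpen_ball.mem_nhds hz] with y hy
      refine (key y hy).trans ?_
      rw [Real.norm_of_nonneg (by positivity), mul_assoc (|gronwallBound 0 K 1 t|)]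
      gcongr
      exact le_abs_self _
    · exact Asymptotics.isLittleO_pow_sub_sub z one_lt_two

/-! ### Coordinate changes of the metric and the Christoffel symbols -/

namespace RiemannianExp

variable {E : Type*} [NormedAddCommGroup E] [NormedSpace ℝ E]
  {M : Type*} [TopologicalSpace M] [ChartedSpace E M]

/-- The coordinate change from the preferred chart at `y` to the preferred chart at `z`. -/
noncomputable def transition (E : Type*) [NormedAddCommGroup E] [NormedSpace ℝ E]
    {M : Type*} [TopologicalSpace M] [ChartedSpace E M] (y z : M) (p : E) : E :=
  extChartAt 𝓘(ℝ, E) z ((extChartAt 𝓘(ℝ, E) y).symm p)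

/-- The set on which the coordinate change is smooth. -/
def overlap (E : Type*) [NormedAddCommGroup E] [NormedSpace ℝ E]
    {M : Type*} [TopologicalSpace M] [ChartedSpace E M] (y z : M) : Set E :=
  (extChartAt 𝓘(ℝ, E) y).target ∩
    (extChartAt 𝓘(ℝ, E) y).symm ⁻¹' (extChartAt 𝓘(ℝ, E) z).source

theorem isOpen_overlap (y z : M) : IsOpen (overlap E y z) :=
  (continuousOn_extChartAt_symm y).isOpen_inter_preimage (isOpen_extChartAt_target y)
    (isOpen_extChartAt_source z)

section

variable [IsManifold 𝓘(ℝ, E) ∞ M]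

theorem contMDiffAt_extChartAt_symm {y : M} {p : E} (hp : p ∈ (extChartAt 𝓘(ℝ, E) y).target) :
    ContMDiffAt 𝓘(ℝ, E) 𝓘(ℝ, E) ∞ (extChartAt 𝓘(ℝ, E) y).symm p :=
  (contMDiffOn_extChartAt_symm y).contMDiffAt ((isOpen_extChartAt_target y).mem_nhds hp)

theorem mdifferentiableAt_extChartAt_symm {y : M} {p : E}
    (hp : p ∈ (extChartAt 𝓘(ℝ, E) y).target) :
    MDifferentiableAt 𝓘(ℝ, E) 𝓘(ℝ, E) (extChartAt 𝓘(ℝ, E) y).symm p :=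
  (contMDiffAt_extChartAt_symm hp).mdifferentiableAt (by simp)

theorem mfderiv_extChartAt_symm_injective {y : M} {p : E}
    (hp : p ∈ (extChartAt 𝓘(ℝ, E) y).target) :
    Function.Injective (mfderiv 𝓘(ℝ, E) 𝓘(ℝ, E) (extChartAt 𝓘(ℝ, E) y).symm p) := by
  have : IsManifold 𝓘(ℝ, E) 1 M := IsManifold.of_le (n := ∞) (by simp)
  have h := isInvertible_mfderivWithin_extChartAt_symm (I := 𝓘(ℝ, E)) hp
  simp only [modelWithCornersSelf_coe, Set.range_id, mfderivWithin_univ] at h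
  exact h.injective

/-- In finite dimension it suffices to test on constant vectors; each entry is then `g` evaluated on
two smooth coordinate fields. -/
theorem contDiffOn_localMetric [FiniteDimensional ℝ E] (g : Metric E M) (y : M) :
    ContDiffOn ℝ ∞ (localMetric g y) (extChartAt 𝓘(ℝ, E) y).target := by
  have hsec : ∀ u : E, ContMDiffOn 𝓘(ℝ, E) 𝓘(ℝ, E).tangent ∞
      (fun p ↦ (⟨(extChartAt 𝓘(ℝ, E) y).symm p,
        mfderiv 𝓘(ℝ, E) 𝓘(ℝ, E) (extChartAt 𝓘(ℝ, E) y).symm p u⟩ : TangentBundle 𝓘(ℝ, E) M))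
      (extChartAt 𝓘(ℝ, E) y).target := by
    intro u
    have h1 := (contMDiffOn_extChartAt_symm (I := 𝓘(ℝ, E)) (n := ∞) y).contMDiffOn_tangentMapWithin
      (m := ∞) (by simp) (isOpen_extChartAt_target y).uniqueMDiffOn
    have h2 : ContMDiff 𝓘(ℝ, E) 𝓘(ℝ, E).tangent ∞
        (fun p : E ↦ (⟨p, u⟩ : TangentBundle 𝓘(ℝ, E) E)) :=
      contMDiff_vectorSpace_iff_contDiff.2 contDiff_const
    refine (h1.comp h2.contMDiffOn (fun p hp ↦ hp)).congr (fun p hp ↦ ?_)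
    simp only [Function.comp, tangentMapWithin]
    rw [mfderivWithin_of_isOpen (isOpen_extChartAt_target y) hp]
  rw [contDiffOn_clm_apply]
  intro u
  rw [contDiffOn_clm_apply]
  intro w p hp
  rw [← contMDiffWithinAt_iff_contDiffWithinAt]
  have : ContMDiffWithinAt 𝓘(ℝ, E) (𝓘(ℝ, E).prod 𝓘(ℝ)) ∞
      (fun m ↦ Bundle.TotalSpace.mk' ℝ (E := Bundle.Trivial M ℝ) ((extChartAt 𝓘(ℝ, E) y).symm m)
        (g.inner ((extChartAt 𝓘(ℝ, E) y).symm m)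
          (mfderiv 𝓘(ℝ, E) 𝓘(ℝ, E) (extChartAt 𝓘(ℝ, E) y).symm m u)
          (mfderiv 𝓘(ℝ, E) 𝓘(ℝ, E) (extChartAt 𝓘(ℝ, E) y).symm m w)))
      (extChartAt 𝓘(ℝ, E) y).target p := by
    apply ContMDiffWithinAt.clm_bundle_apply₂ (F₁ := E) (F₂ := E)
    · exact ContMDiffAt.comp_contMDiffWithinAt p g.contMDiff.contMDiffAt
        (contMDiffAt_extChartAt_symm hp).contMDiffWithinAt
    · exact hsec u p hp
    · exact hsec w p hp
  simp only [Bundle.contMDiffWithinAt_totalSpace] at this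
  exact this.2

theorem localMetric_apply (g : Metric E M) (y : M) (p u w : E) :
    localMetric g y p u w = g.inner ((extChartAt 𝓘(ℝ, E) y).symm p)
      (mfderiv 𝓘(ℝ, E) 𝓘(ℝ, E) (extChartAt 𝓘(ℝ, E) y).symm p u)
      (mfderiv 𝓘(ℝ, E) 𝓘(ℝ, E) (extChartAt 𝓘(ℝ, E) y).symm p w) := rfl

theorem localMetric_symm (g : Metric E M) (y : M) (p u w : E) :
    localMetric g y p u w = localMetric g y p w u := by
  rw [localMetric_apply, localMetric_apply, g.symm]

theorem localMetric_injective (g : Metric E M) {y : M} {p : E}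
    (hp : p ∈ (extChartAt 𝓘(ℝ, E) y).target) : Function.Injective (localMetric g y p) := by
  rw [injective_iff_map_eq_zero]
  intro u hu
  by_contra hne
  have hA : mfderiv 𝓘(ℝ, E) 𝓘(ℝ, E) (extChartAt 𝓘(ℝ, E) y).symm p u ≠ 0 := fun h ↦
    hne (mfderiv_extChartAt_symm_injective hp (h.trans (map_zero _).symm))
  have h := g.pos _ _ hA
  rw [← localMetric_apply, hu] at h
  simp at h

/-- Positivity gives injectivity, and `E` has the same dimension as its dual. -/
theorem localMetric_isInvertible [FiniteDimensional ℝ E] (g : Metric E M) {y : M} {p : E}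
    (hp : p ∈ (extChartAt 𝓘(ℝ, E) y).target) : (localMetric g y p).IsInvertible := by
  have hfr : Module.finrank ℝ E = Module.finrank ℝ (E →L[ℝ] ℝ) := by
    rw [← LinearEquiv.finrank_eq (LinearMap.toContinuousLinearMap (𝕜 := ℝ) (E := E) (F' := ℝ))]
    exact (Subspace.dual_finrank_eq (K := ℝ) (V := E)).symm
  exact ⟨(LinearEquiv.ofInjectiveOfFinrankEq (localMetric g y p).toLinearMap
    (localMetric_injective g hp) hfr).toContinuousLinearEquiv, by ext; rfl⟩

theorem contDiffAt_transition {y z : M} {p : E} (hp : p ∈ overlap E y z) :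
    ContDiffAt ℝ ∞ (transition E y z) p := by
  rw [← contMDiffAt_iff_contDiffAt]
  refine ContMDiffAt.comp p (g := extChartAt 𝓘(ℝ, E) z) (contMDiffAt_extChartAt' ?_)
    (contMDiffAt_extChartAt_symm hp.1)
  simpa using hp.2

theorem mfderiv_extChartAt_symm_eq_comp {y z : M} {p : E} (hp : p ∈ overlap E y z) (u : E) :
    mfderiv 𝓘(ℝ, E) 𝓘(ℝ, E) (extChartAt 𝓘(ℝ, E) y).symm p u =
      mfderiv 𝓘(ℝ, E) 𝓘(ℝ, E) (extChartAt 𝓘(ℝ, E) z).symm (transition E y z p)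
        (fderiv ℝ (transition E y z) p u) := by
  have hev : (extChartAt 𝓘(ℝ, E) y).symm =ᶠ[𝓝 p]
      (extChartAt 𝓘(ℝ, E) z).symm ∘ transition E y z := by
    filter_upwards [(isOpen_overlap y z).mem_nhds hp] with q hq
    simp only [Function.comp, transition]
    rw [PartialEquiv.left_inv _ hq.2]
  have ht : transition E y z p ∈ (extChartAt 𝓘(ℝ, E) z).target :=
    PartialEquiv.map_source _ hp.2
  have h := ((mdifferentiableAt_extChartAt_symm ht).hasMFDerivAt.comp p
    ((contDiffAt_transition hp).differentiableAt
      (by simp)).mdifferentiableAt.hasMFDerivAt).congr_of_eventuallyEq hev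
  rw [mfderiv_eq_fderiv] at h
  exact congrArg (fun T : E →L[ℝ] E ↦ T u) h.mfderiv

theorem fderiv_transition_surjective [FiniteDimensional ℝ E] {y z : M} {p : E}
    (hp : p ∈ overlap E y z) : Function.Surjective (fderiv ℝ (transition E y z) p) := by
  refine LinearMap.surjective_of_injective (f := (fderiv ℝ (transition E y z) p).toLinearMap) ?_
  intro u w huw
  refine mfderiv_extChartAt_symm_injective hp.1 ?_
  rw [mfderiv_extChartAt_symm_eq_comp hp, mfderiv_extChartAt_symm_eq_comp hp]
  exact congrArg _ huw

theorem localMetric_eq_transition (g : Metric E M) {y z : M} {p : E} (hp : p ∈ overlap E y z)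
    (u w : E) :
    localMetric g y p u w = localMetric g z (transition E y z p)
      (fderiv ℝ (transition E y z) p u) (fderiv ℝ (transition E y z) p w) := by
  have hx : (extChartAt 𝓘(ℝ, E) z).symm (transition E y z p) = (extChartAt 𝓘(ℝ, E) y).symm p :=
    PartialEquiv.left_inv _ hp.2
  rw [localMetric_apply, localMetric_apply, mfderiv_extChartAt_symm_eq_comp hp u,
    mfderiv_extChartAt_symm_eq_comp hp w]
  -- Both fibres are read as `E`, so that equality of base points can be substituted without
  -- transporting vectors.
  have key : ∀ {a b : M} (_ : a = b) (u w : E),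
      (g.inner a : E →L[ℝ] E →L[ℝ] ℝ) u w = (g.inner b : E →L[ℝ] E →L[ℝ] ℝ) u w := by
    rintro a _ rfl u w; rfl
  exact key hx.symm _ _

/-- The transformation law of the derivative of the metric under a coordinate change. -/
theorem fderiv_localMetric_eq_transition [FiniteDimensional ℝ E] (g : Metric E M) {y z : M} {p : E}
    (hp : p ∈ overlap E y z) (a u w : E) :
    fderiv ℝ (localMetric g y) p a u w =
      fderiv ℝ (localMetric g z) (transition E y z p) (fderiv ℝ (transition E y z) p a)
        (fderiv ℝ (transition E y z) p u) (fderiv ℝ (transition E y z) p w)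
      + localMetric g z (transition E y z p) (fderiv ℝ (fderiv ℝ (transition E y z)) p a u)
        (fderiv ℝ (transition E y z) p w)
      + localMetric g z (transition E y z p) (fderiv ℝ (transition E y z) p u)
        (fderiv ℝ (fderiv ℝ (transition E y z)) p a w) := by
  have ht : transition E y z p ∈ (extChartAt 𝓘(ℝ, E) z).target :=
    PartialEquiv.map_source _ hp.2
  have hφ := contDiffAt_transition hp
  have hGy : HasFDerivAt (localMetric g y) (fderiv ℝ (localMetric g y) p) p :=
    (((contDiffOn_localMetric g y).contDiffAt
      ((isOpen_extChartAt_target y).mem_nhds hp.1)).differentiableAt (by simp)).hasFDerivAt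
  have hGz : HasFDerivAt (localMetric g z) (fderiv ℝ (localMetric g z) (transition E y z p))
      (transition E y z p) :=
    (((contDiffOn_localMetric g z).contDiffAt
      ((isOpen_extChartAt_target z).mem_nhds ht)).differentiableAt (by simp)).hasFDerivAt
  have hφ1 : HasFDerivAt (transition E y z) (fderiv ℝ (transition E y z) p) p :=
    (hφ.differentiableAt (by simp)).hasFDerivAt
  have hφ2 : HasFDerivAt (fderiv ℝ (transition E y z)) (fderiv ℝ (fderiv ℝ (transition E y z)) p) p :=
    ((hφ.fderiv_right (m := ∞) (by simp)).differentiableAt (by simp)).hasFDerivAt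
  have h1 := (hGy.clm_apply (hasFDerivAt_const u p)).clm_apply (hasFDerivAt_const w p)
  have hGφ : HasFDerivAt (fun q ↦ localMetric g z (transition E y z q))
      ((fderiv ℝ (localMetric g z) (transition E y z p)).comp (fderiv ℝ (transition E y z) p)) p :=
    HasFDerivAt.comp (g := localMetric g z) p hGz hφ1
  have h2 := (hGφ.clm_apply (hφ2.clm_apply (hasFDerivAt_const u p))).clm_apply
    (hφ2.clm_apply (hasFDerivAt_const w p))
  -- The invariance of the metric holds on an open set, so both sides may be differentiated.
  have hev : (fun q ↦ localMetric g y q u w) =ᶠ[𝓝 p] fun q ↦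
      localMetric g z (transition E y z q)
        (fderiv ℝ (transition E y z) q u) (fderiv ℝ (transition E y z) q w) := by
    filter_upwards [(isOpen_overlap y z).mem_nhds hp] with q hq
    exact localMetric_eq_transition g hq u w
  have h3 := congrArg (fun T : E →L[ℝ] ℝ ↦ T a) (h1.unique (h2.congr_of_eventuallyEq hev))
  simp at h3
  rw [h3]
  ring

/-- The transformation law of the Christoffel symbols. -/
theorem christoffel_eq_transition [FiniteDimensional ℝ E] (g : Metric E M) {y z : M} {p : E}
    (hp : p ∈ overlap E y z) (u v w : E) :
    christoffel g y p u v w =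
      christoffel g z (transition E y z p) (fderiv ℝ (transition E y z) p u)
        (fderiv ℝ (transition E y z) p v) (fderiv ℝ (transition E y z) p w)
      + localMetric g z (transition E y z p) (fderiv ℝ (fderiv ℝ (transition E y z)) p u v)
        (fderiv ℝ (transition E y z) p w) := by
  -- Of the six second-derivative terms, symmetry cancels four; the other two coincide and absorb
  -- the factor 1/2.
  have hsymm : IsSymmSndFDerivAt ℝ (transition E y z) p :=
    (contDiffAt_transition hp).isSymmSndFDerivAt (by
      simpa using (WithTop.coe_le_coe.2 (le_top : (2 : ℕ∞) ≤ ⊤)))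
  simp only [christoffel, fderiv_localMetric_eq_transition g hp]
  rw [hsymm.eq w u, hsymm.eq w v, hsymm.eq v u,
    localMetric_symm g z _ (fderiv ℝ (transition E y z) p v),
    localMetric_symm g z _ (fderiv ℝ (transition E y z) p u)]
  ring

end

end RiemannianExp

/-! ### The geodesic equation at a single time and its chart independence -/

theorem ContDiffAt.differentiableAt_deriv {F : Type*} [NormedAddCommGroup F]
    [NormedSpace ℝ F] {c : ℝ → F} {t : ℝ} (hc : ContDiffAt ℝ 2 c t) :
    DifferentiableAt ℝ (deriv c) t :=
  ((hc.fderiv_right (m := 1) (by norm_num)).differentiableAt (by simp)).clm_apply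
    (differentiableAt_const 1)

theorem hasDerivAt_fderiv_comp_apply {F G : Type*} [NormedAddCommGroup F] [NormedSpace ℝ F]
    [NormedAddCommGroup G] [NormedSpace ℝ G] {φ : F → G} {A : F →L[ℝ] F →L[ℝ] G} {c d : ℝ → F}
    {c' d' : F} {t : ℝ} (hφ : HasFDerivAt (fderiv ℝ φ) A (c t)) (hc : HasDerivAt c c' t)
    (hd : HasDerivAt d d' t) :
    HasDerivAt (fun τ ↦ fderiv ℝ φ (c τ) (d τ)) (A c' (d t) + fderiv ℝ φ (c t) d') t := by
  have h : HasDerivAt (fun τ ↦ fderiv ℝ φ (c τ)) (A c') t := hφ.comp_hasDerivAt t hc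
  exact h.clm_apply hd

namespace RiemannianExp

variable {E : Type*} [NormedAddCommGroup E] [NormedSpace ℝ E]
  {M : Type*} [TopologicalSpace M] [ChartedSpace E M]

/-- The position and velocity of a curve in the preferred chart at `y`. -/
noncomputable def state (y : M) (γ : ℝ → M) (t : ℝ) : E × E :=
  (extChartAt 𝓘(ℝ, E) y (γ t), deriv (fun τ ↦ extChartAt 𝓘(ℝ, E) y (γ τ)) t)

theorem state_congr {y : M} {γ γ' : ℝ → M} {t : ℝ} (h : γ =ᶠ[𝓝 t] γ') :
    (state y γ t : E × E) = state y γ' t := by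
  simp only [state]
  rw [h.eq_of_nhds, Filter.EventuallyEq.deriv_eq (f := fun τ ↦ extChartAt 𝓘(ℝ, E) y (γ' τ))
    (by filter_upwards [h] with τ hτ; rw [hτ])]

theorem state_comp_sub (y : M) (γ : ℝ → M) (s t : ℝ) :
    (state y (fun τ ↦ γ (τ - s)) t : E × E) = state y γ (t - s) := by
  simp only [state]
  rw [deriv_comp_sub_const (f := fun τ ↦ extChartAt 𝓘(ℝ, E) y (γ τ))]

theorem state_comp_mul (y : M) (γ : ℝ → M) (s t : ℝ) :
    (state y (fun τ ↦ γ (s * τ)) t : E × E) =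
      ((state y γ (s * t) : E × E).1, s • (state y γ (s * t) : E × E).2) := by
  simp only [state]
  rw [deriv_comp_mul_left s (f := fun τ ↦ extChartAt 𝓘(ℝ, E) y (γ τ))]

theorem extChartAt_mem_overlap {y z q : M} (hy : q ∈ (chartAt E y).source)
    (hz : q ∈ (chartAt E z).source) : extChartAt 𝓘(ℝ, E) y q ∈ overlap E y z := by
  have hy' : q ∈ (extChartAt 𝓘(ℝ, E) y).source := by simpa using hy
  refine ⟨PartialEquiv.map_source _ hy', ?_⟩
  rw [Set.mem_preimage, PartialEquiv.left_inv _ hy']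
  simpa using hz

theorem eventually_extChartAt_eq_transition {γ : ℝ → M} {t : ℝ} {y : M} (z : M)
    (hγ : ContinuousAt γ t) (hy : γ t ∈ (chartAt E y).source) :
    (fun τ ↦ extChartAt 𝓘(ℝ, E) z (γ τ)) =ᶠ[𝓝 t]
      fun τ ↦ transition E y z (extChartAt 𝓘(ℝ, E) y (γ τ)) := by
  filter_upwards [hγ.eventually_mem ((chartAt E y).open_source.mem_nhds hy)] with τ hτ
  rw [transition, PartialEquiv.left_inv _ (by simpa using hτ)]

variable [IsManifold 𝓘(ℝ, E) ∞ M]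

theorem contDiffAt_extChartAt_comp {γ : ℝ → M} {t : ℝ} {y : M}
    (hγ : ContMDiffAt 𝓘(ℝ, ℝ) 𝓘(ℝ, E) 2 γ t) (hy : γ t ∈ (chartAt E y).source) :
    ContDiffAt ℝ 2 (fun τ ↦ extChartAt 𝓘(ℝ, E) y (γ τ)) t := by
  rw [← contMDiffAt_iff_contDiffAt]
  have : IsManifold 𝓘(ℝ, E) 2 M := IsManifold.of_le (n := ∞)
    (WithTop.coe_le_coe.2 (le_top : (2 : ℕ∞) ≤ ⊤))
  exact (contMDiffAt_extChartAt' hy).comp t hγ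

/-- The tangent map of the coordinate change. -/
noncomputable def transitionState (E : Type*) [NormedAddCommGroup E] [NormedSpace ℝ E]
    {M : Type*} [TopologicalSpace M] [ChartedSpace E M] (y z : M) (q : E × E) : E × E :=
  (transition E y z q.1, fderiv ℝ (transition E y z) q.1 q.2)

theorem state_eq_transitionState {γ : ℝ → M} {t : ℝ} {y z : M}
    (hγ : ContMDiffAt 𝓘(ℝ, ℝ) 𝓘(ℝ, E) 2 γ t) (hy : γ t ∈ (chartAt E y).source)
    (hz : γ t ∈ (chartAt E z).source) :
    state z γ t = transitionState E y z (state y γ t) := by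
  have hev := eventually_extChartAt_eq_transition z hγ.continuousAt hy
  have hφ := (contDiffAt_transition (extChartAt_mem_overlap hy hz)).differentiableAt (by simp)
  have hc := (contDiffAt_extChartAt_comp hγ hy).differentiableAt (by simp)
  refine Prod.ext hev.eq_of_nhds ?_
  simp only [state, transitionState]
  rw [hev.deriv_eq]
  exact (hφ.hasFDerivAt.comp_hasDerivAt t hc.hasDerivAt).deriv

theorem differentiableAt_transitionState {y z : M} {q : E × E} (hq : q.1 ∈ overlap E y z) :
    DifferentiableAt ℝ (transitionState E y z) q := by
  have hφ := contDiffAt_transition hq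
  have h1 : DifferentiableAt ℝ (fun q : E × E ↦ transition E y z q.1) q :=
    (hφ.differentiableAt (by simp)).comp q differentiableAt_fst
  have h2 : DifferentiableAt ℝ (fun q : E × E ↦ fderiv ℝ (transition E y z) q.1) q :=
    ((hφ.fderiv_right (m := ∞) (by simp)).differentiableAt (by simp)).comp q differentiableAt_fst
  exact h1.prodMk (h2.clm_apply differentiableAt_snd)

/-- The geodesic equation at one time, in the preferred chart at `y`. -/
def GeodesicEquationAt (g : Metric E M) (y : M) (γ : ℝ → M) (t : ℝ) : Prop :=
  ∀ w : E, localMetric g y (state y γ t : E × E).1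
      (deriv (deriv fun τ ↦ extChartAt 𝓘(ℝ, E) y (γ τ)) t) w
    + christoffel g y (state y γ t : E × E).1 (state y γ t : E × E).2
      (state y γ t : E × E).2 w = 0

/-- A curve is a geodesic at a time `t` if it is `C²` there and satisfies the geodesic equation. -/
structure IsGeodesicAt (g : Metric E M) (γ : ℝ → M) (t : ℝ) : Prop where
  contMDiffAt : ContMDiffAt 𝓘(ℝ, ℝ) 𝓘(ℝ, E) 2 γ t
  equation : ∀ y : M, γ t ∈ (chartAt E y).source → GeodesicEquationAt g y γ t

theorem isGeodesicOn_iff (g : Metric E M) (γ : ℝ → M) {s : Set ℝ} (hs : IsOpen s) :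
    IsGeodesicOn g γ s ↔ ∀ t ∈ s, IsGeodesicAt g γ t :=
  ⟨fun h t ht ↦ ⟨h.contMDiffOn.contMDiffAt (hs.mem_nhds ht), h.equation t ht⟩,
    fun h ↦ ⟨fun t ht ↦ (h t ht).contMDiffAt.contMDiffWithinAt, fun t ht ↦ (h t ht).equation⟩⟩

theorem IsGeodesicAt.congr {g : Metric E M} {γ γ' : ℝ → M} {t : ℝ} (h : IsGeodesicAt g γ t)
    (heq : γ' =ᶠ[𝓝 t] γ) : IsGeodesicAt g γ' t := by
  refine ⟨h.contMDiffAt.congr_of_eventuallyEq heq, fun y hy w ↦ ?_⟩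
  rw [heq.eq_of_nhds] at hy
  have hc : (fun τ ↦ extChartAt 𝓘(ℝ, E) y (γ' τ)) =ᶠ[𝓝 t] fun τ ↦ extChartAt 𝓘(ℝ, E) y (γ τ) := by
    filter_upwards [heq] with τ hτ
    rw [hτ]
  rw [state_congr heq, hc.deriv.deriv_eq]
  exact h.equation y hy w

theorem IsGeodesicAt.comp_sub {g : Metric E M} {γ : ℝ → M} {s t : ℝ}
    (h : IsGeodesicAt g γ (t - s)) : IsGeodesicAt g (fun τ ↦ γ (τ - s)) t := by
  refine ⟨ContMDiffAt.comp t (g := γ) (f := fun τ ↦ τ - s) h.contMDiffAt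
    (contDiffAt_id.sub contDiffAt_const).contMDiffAt, fun y hy w ↦ ?_⟩
  have hd : deriv (fun τ ↦ extChartAt 𝓘(ℝ, E) y (γ (τ - s))) =
      fun τ ↦ deriv (fun τ ↦ extChartAt 𝓘(ℝ, E) y (γ τ)) (τ - s) :=
    funext fun τ ↦ deriv_comp_sub_const (f := fun τ ↦ extChartAt 𝓘(ℝ, E) y (γ τ)) s τ
  rw [state_comp_sub, hd, deriv_comp_sub_const]
  exact h.equation y hy w

/-- Acceleration and the quadratic Christoffel term both scale by `s²`; `s = 0` is allowed. -/
theorem IsGeodesicAt.comp_mul {g : Metric E M} {γ : ℝ → M} {s t : ℝ}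
    (h : IsGeodesicAt g γ (s * t)) : IsGeodesicAt g (fun τ ↦ γ (s * τ)) t := by
  refine ⟨ContMDiffAt.comp t (g := γ) (f := fun τ ↦ s * τ) h.contMDiffAt
    (contDiffAt_const.mul contDiffAt_id).contMDiffAt, fun y hy w ↦ ?_⟩
  have hd : deriv (fun τ ↦ extChartAt 𝓘(ℝ, E) y (γ (s * τ))) =
      fun τ ↦ s • deriv (fun τ ↦ extChartAt 𝓘(ℝ, E) y (γ τ)) (s * τ) :=
    funext fun τ ↦ deriv_comp_mul_left s (fun τ ↦ extChartAt 𝓘(ℝ, E) y (γ τ)) τ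
  have hdd : deriv (deriv (fun τ ↦ extChartAt 𝓘(ℝ, E) y (γ (s * τ)))) t =
      s • s • deriv (deriv (fun τ ↦ extChartAt 𝓘(ℝ, E) y (γ τ))) (s * t) := by
    rw [hd, deriv_fun_const_smul_field, deriv_comp_mul_left]
  rw [state_comp_mul, hdd]
  have := h.equation y hy w
  simp only [christoffel, map_smul, smul_apply, smul_eq_mul] at this ⊢
  linear_combination (s * s) * this

theorem isGeodesicAt_const (g : Metric E M) (q : M) (t : ℝ) : IsGeodesicAt g (fun _ ↦ q) t :=
  ⟨contMDiffAt_const, fun y _ w ↦ by simp [christoffel, state]⟩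

/-- The functional `w ↦ Γ(u, u; w)`. -/
noncomputable def christoffelForm (g : Metric E M) (y : M) (q : E × E) : E →L[ℝ] ℝ :=
  fderiv ℝ (localMetric g y) q.1 q.2 q.2 -
    (1 / 2 : ℝ) • ((fderiv ℝ (localMetric g y) q.1).flip q.2).flip q.2

theorem christoffelForm_apply (g : Metric E M) (y : M) (q : E × E) (w : E) :
    christoffelForm g y q w = christoffel g y q.1 q.2 q.2 w := by
  simp [christoffelForm, christoffel]
  ring

variable [FiniteDimensional ℝ E]

/-- The second derivative of the coordinate change φ that appears in (φ ∘ c)'' is exactly the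
inhomogeneous term in the transformation law of the Christoffel symbols. -/
theorem GeodesicEquationAt.of_chart {g : Metric E M} {γ : ℝ → M} {t : ℝ} {y z : M}
    (hγ : ContMDiffAt 𝓘(ℝ, ℝ) 𝓘(ℝ, E) 2 γ t) (hy : γ t ∈ (chartAt E y).source)
    (hz : γ t ∈ (chartAt E z).source) (h : GeodesicEquationAt g y γ t) :
    GeodesicEquationAt g z γ t := by
  intro w'
  have hp := extChartAt_mem_overlap hy hz
  obtain ⟨w, rfl⟩ := fderiv_transition_surjective hp w'
  -- The velocity law is needed on a neighbourhood of `t`, since it is differentiated once more.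
  have hev : ∀ᶠ τ in 𝓝 t, deriv (fun τ ↦ extChartAt 𝓘(ℝ, E) z (γ τ)) τ =
      fderiv ℝ (transition E y z) (extChartAt 𝓘(ℝ, E) y (γ τ))
        (deriv (fun τ ↦ extChartAt 𝓘(ℝ, E) y (γ τ)) τ) := by
    filter_upwards [(contMDiffAt_iff_contMDiffAt_nhds (by simp)).1 hγ, hγ.continuousAt.eventually_mem
      ((chartAt E y).open_source.mem_nhds hy), hγ.continuousAt.eventually_mem
      ((chartAt E z).open_source.mem_nhds hz)] with τ h1 h2 h3
    exact congrArg Prod.snd (state_eq_transitionState h1 h2 h3)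
  have hc := contDiffAt_extChartAt_comp hγ hy
  have hc1 := (hc.differentiableAt (by simp)).hasDerivAt
  have hc2 := hc.differentiableAt_deriv.hasDerivAt
  have hφ := contDiffAt_transition hp
  have hφ2 := ((hφ.fderiv_right (m := ∞) (by simp)).differentiableAt (by simp)).hasFDerivAt
  have hdd : deriv (deriv fun τ ↦ extChartAt 𝓘(ℝ, E) z (γ τ)) t =
      fderiv ℝ (fderiv ℝ (transition E y z)) (extChartAt 𝓘(ℝ, E) y (γ t))
        (deriv (fun τ ↦ extChartAt 𝓘(ℝ, E) y (γ τ)) t)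
        (deriv (fun τ ↦ extChartAt 𝓘(ℝ, E) y (γ τ)) t)
      + fderiv ℝ (transition E y z) (extChartAt 𝓘(ℝ, E) y (γ t))
        (deriv (deriv fun τ ↦ extChartAt 𝓘(ℝ, E) y (γ τ)) t) := by
    rw [Filter.EventuallyEq.deriv_eq hev]
    exact (hasDerivAt_fderiv_comp_apply hφ2 hc1 hc2).deriv
  have heq := h w
  rw [state_eq_transitionState hγ hy hz, hdd]
  simp only [state, transitionState] at heq ⊢
  rw [localMetric_eq_transition g hp, christoffel_eq_transition g hp] at heq
  rw [map_add, add_apply]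
  linear_combination heq

/-! ### The geodesic spray: regularity, local uniqueness and local flow -/

/-- The geodesic spray in the preferred chart at `y`. -/
noncomputable def spray (g : Metric E M) (y : M) (q : E × E) : E × E :=
  (q.2, -(localMetric g y q.1).inverse (christoffelForm g y q))

set_option maxSynthPendingDepth 5 in
theorem contDiffAt_spray (g : Metric E M) {y : M} {q : E × E}
    (hq : q.1 ∈ (extChartAt 𝓘(ℝ, E) y).target) : ContDiffAt ℝ ∞ (spray g y) q := by
  have hG := (contDiffOn_localMetric g y).contDiffAt ((isOpen_extChartAt_target y).mem_nhds hq)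
  have hG1 : ContDiffAt ℝ ∞ (fun q : E × E ↦ localMetric g y q.1) q := hG.comp q contDiffAt_fst
  have hinv : ContDiffAt ℝ ∞ (fun q : E × E ↦ (localMetric g y q.1).inverse) q :=
    ContDiffAt.comp q (g := ContinuousLinearMap.inverse)
      (localMetric_isInvertible g hq).contDiffAt_map_inverse hG1
  have hDG : ContDiffOn ℝ ∞ (fun q : E × E ↦ fderiv ℝ (localMetric g y) q.1)
      (Prod.fst ⁻¹' (extChartAt 𝓘(ℝ, E) y).target) :=
    ((contDiffOn_localMetric g y).fderiv_of_isOpen (isOpen_extChartAt_target y)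
      (m := ∞) (by simp)).comp contDiffOn_fst (fun _ h ↦ h)
  have hΓ : ContDiffOn ℝ ∞ (christoffelForm g y)
      (Prod.fst ⁻¹' (extChartAt 𝓘(ℝ, E) y).target) := by
    rw [contDiffOn_clm_apply]
    intro w
    refine (((hDG.clm_apply contDiffOn_snd).clm_apply contDiffOn_snd).clm_apply
      contDiffOn_const).sub (contDiffOn_const.mul
      (((hDG.clm_apply contDiffOn_const).clm_apply contDiffOn_snd).clm_apply contDiffOn_snd))
  have hΓ := hΓ.contDiffAt
    (((isOpen_extChartAt_target y).preimage continuous_fst).mem_nhds hq)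
  exact contDiffAt_snd.prodMk (hinv.clm_apply hΓ).neg

/-- Invertibility of the metric raises the index and solves the equation for the second derivative.
-/
theorem geodesicEquationAt_iff (g : Metric E M) {y : M} {γ : ℝ → M} {t : ℝ}
    (hy : γ t ∈ (chartAt E y).source) :
    GeodesicEquationAt g y γ t ↔
      deriv (deriv fun τ ↦ extChartAt 𝓘(ℝ, E) y (γ τ)) t = (spray g y (state y γ t)).2 := by
  have hp : (state y γ t : E × E).1 ∈ (extChartAt 𝓘(ℝ, E) y).target :=
    PartialEquiv.map_source _ (by simpa using hy)
  obtain ⟨e, he⟩ := localMetric_isInvertible g hp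
  have h1 : GeodesicEquationAt g y γ t ↔ localMetric g y (state y γ t : E × E).1
      (deriv (deriv fun τ ↦ extChartAt 𝓘(ℝ, E) y (γ τ)) t) =
        -christoffelForm g y (state y γ t) := by
    rw [ContinuousLinearMap.ext_iff]
    simp only [GeodesicEquationAt, neg_apply, christoffelForm_apply,
      eq_neg_iff_add_eq_zero]
  rw [h1, spray, ← he, ContinuousLinearMap.inverse_equiv]
  constructor
  · intro h
    rw [← map_neg, ← h]
    simp
  · intro h
    rw [h]
    simp

end RiemannianExp

/-- A curve whose derivative is `C¹` on an open set is `C²` there. -/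
theorem contDiffOn_two_of_hasDerivAt {F : Type*} [NormedAddCommGroup F] [NormedSpace ℝ F]
    {c d e : ℝ → F} {s : Set ℝ} (hs : IsOpen s) (hc : ∀ t ∈ s, HasDerivAt c (d t) t)
    (hd : ∀ t ∈ s, HasDerivAt d (e t) t) (he : ContinuousOn e s) : ContDiffOn ℝ 2 c s := by
  have hd1 : ContDiffOn ℝ 1 d s := by
    rw [show (1 : WithTop ℕ∞) = 0 + 1 from rfl, contDiffOn_succ_iff_deriv_of_isOpen hs]
    refine ⟨fun t ht ↦ (hd t ht).differentiableAt.differentiableWithinAt, by simp, ?_⟩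
    rw [contDiffOn_zero]
    exact he.congr fun t ht ↦ (hd t ht).deriv
  rw [show (2 : WithTop ℕ∞) = 1 + 1 by norm_num, contDiffOn_succ_iff_deriv_of_isOpen hs]
  exact ⟨fun t ht ↦ (hc t ht).differentiableAt.differentiableWithinAt, by simp,
    hd1.congr fun t ht ↦ (hc t ht).deriv⟩

namespace RiemannianExp

variable {E : Type*} [NormedAddCommGroup E] [NormedSpace ℝ E] [FiniteDimensional ℝ E]
  {M : Type*} [TopologicalSpace M] [ChartedSpace E M] [IsManifold 𝓘(ℝ, E) ∞ M]

theorem IsGeodesicAt.hasDerivAt_state {g : Metric E M} {γ : ℝ → M} {t : ℝ} {y : M}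
    (h : IsGeodesicAt g γ t) (hy : γ t ∈ (chartAt E y).source) :
    HasDerivAt (state y γ) (spray g y (state y γ t)) t := by
  have hc := contDiffAt_extChartAt_comp h.contMDiffAt hy
  have h2 := (geodesicEquationAt_iff g hy).1 (h.equation y hy)
  have h3 := (hc.differentiableAt (by simp)).hasDerivAt.prodMk hc.differentiableAt_deriv.hasDerivAt
  rw [h2] at h3
  exact h3

/-- Integral curves of the geodesic spray in a chart project to geodesics. -/
theorem isGeodesicAt_of_hasDerivAt_spray (g : Metric E M) {y : M} {q : ℝ → E × E} {s : Set ℝ}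
    (hs : IsOpen s) (hq : ∀ t ∈ s, (q t).1 ∈ (extChartAt 𝓘(ℝ, E) y).target)
    (hd : ∀ t ∈ s, HasDerivAt q (spray g y (q t)) t) {t : ℝ} (ht : t ∈ s) :
    IsGeodesicAt g (fun τ ↦ (extChartAt 𝓘(ℝ, E) y).symm (q τ).1) t ∧
      state y (fun τ ↦ (extChartAt 𝓘(ℝ, E) y).symm (q τ).1) t = q t := by
  set γ : ℝ → M := fun τ ↦ (extChartAt 𝓘(ℝ, E) y).symm (q τ).1
  have hγs : ∀ t ∈ s, γ t ∈ (chartAt E y).source := fun t ht ↦ by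
    rw [← extChartAt_source 𝓘(ℝ, E)]
    exact PartialEquiv.map_target _ (hq t ht)
  have h1 : ∀ t ∈ s, HasDerivAt (fun τ ↦ (q τ).1) (q t).2 t := fun t ht ↦ (hd t ht).fst
  have h2 : ∀ t ∈ s, HasDerivAt (fun τ ↦ (q τ).2) (spray g y (q t)).2 t := fun t ht ↦ (hd t ht).snd
  have h3 : ContinuousOn (fun τ ↦ (spray g y (q τ)).2) s := fun t ht ↦
    ((ContinuousAt.comp (g := spray g y) (contDiffAt_spray g (hq t ht)).continuousAt
      (hd t ht).continuousAt).snd).continuousWithinAt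
  have hC2 := contDiffOn_two_of_hasDerivAt hs h1 h2 h3
  have hc : ∀ t ∈ s, (fun τ ↦ extChartAt 𝓘(ℝ, E) y (γ τ)) =ᶠ[𝓝 t] fun τ ↦ (q τ).1 := fun t ht ↦ by
    filter_upwards [hs.mem_nhds ht] with τ hτ
    exact PartialEquiv.right_inv _ (hq τ hτ)
  have hdc : ∀ t ∈ s, deriv (fun τ ↦ extChartAt 𝓘(ℝ, E) y (γ τ)) t = (q t).2 := fun t ht ↦ by
    rw [(hc t ht).deriv_eq, (h1 t ht).deriv]
  have hst : state y γ t = q t := Prod.ext (hc t ht).eq_of_nhds (hdc t ht)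
  have hγ : ContMDiffAt 𝓘(ℝ, ℝ) 𝓘(ℝ, E) 2 γ t :=
    ContMDiffAt.comp t (g := (extChartAt 𝓘(ℝ, E) y).symm)
      ((contMDiffAt_extChartAt_symm (hq t ht)).of_le
        (WithTop.coe_le_coe.2 (le_top : (2 : ℕ∞) ≤ ⊤)))
      (hC2.contDiffAt (hs.mem_nhds ht)).contMDiffAt
  -- The equation is checked in the chart at `y` only; `GeodesicEquationAt.of_chart` carries it to
  -- all others.
  refine ⟨⟨hγ, fun z hz ↦ GeodesicEquationAt.of_chart hγ (hγs t ht) hz ?_⟩, hst⟩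
  rw [geodesicEquationAt_iff g (hγs t ht), hst]
  have : deriv (fun τ ↦ extChartAt 𝓘(ℝ, E) y (γ τ)) =ᶠ[𝓝 t] fun τ ↦ (q τ).2 := by
    filter_upwards [hs.mem_nhds ht] with τ hτ using hdc τ hτ
  rw [this.deriv_eq, (h2 t ht).deriv]

/-- Two geodesics with the same position and velocity at a time agree near that time. -/
theorem eventuallyEq_of_state_eq {g : Metric E M} {γ₁ γ₂ : ℝ → M} {t : ℝ} {y : M}
    (h₁ : ∀ᶠ τ in 𝓝 t, IsGeodesicAt g γ₁ τ) (h₂ : ∀ᶠ τ in 𝓝 t, IsGeodesicAt g γ₂ τ)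
    (hy₁ : γ₁ t ∈ (chartAt E y).source) (hy₂ : γ₂ t ∈ (chartAt E y).source)
    (heq : (state y γ₁ t : E × E) = state y γ₂ t) : γ₁ =ᶠ[𝓝 t] γ₂ := by
  have hp : (state y γ₁ t : E × E).1 ∈ (extChartAt 𝓘(ℝ, E) y).target :=
    PartialEquiv.map_source _ (by simpa using hy₁)
  -- The spray is locally Lipschitz, so uniqueness for first-order ODEs applies to the two state
  -- curves.
  obtain ⟨K, s, hs, hK⟩ := ((contDiffAt_spray g hp).of_le
    (WithTop.coe_le_coe.2 (le_top : (1 : ℕ∞) ≤ ⊤))).exists_lipschitzOnWith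
  have key : ∀ {γ : ℝ → M}, (∀ᶠ τ in 𝓝 t, IsGeodesicAt g γ τ) → γ t ∈ (chartAt E y).source →
      state y γ t = (state y γ₁ t : E × E) →
      (∀ᶠ τ in 𝓝 t, γ τ ∈ (chartAt E y).source) ∧
      ∀ᶠ τ in 𝓝 t, HasDerivAt (state y γ) (spray g y (state y γ τ)) τ ∧ state y γ τ ∈ s := by
    intro γ h hy hγ
    have hsrc := h.self_of_nhds.contMDiffAt.continuousAt.eventually_mem
      ((chartAt E y).open_source.mem_nhds hy)
    refine ⟨hsrc, ?_⟩
    filter_upwards [h, hsrc, (h.self_of_nhds.hasDerivAt_state hy).continuousAt.eventually_mem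
      (by rw [hγ]; exact hs)] with τ h1 h2 h3
    exact ⟨h1.hasDerivAt_state h2, h3⟩
  obtain ⟨hs₁, hd₁⟩ := key h₁ hy₁ rfl
  obtain ⟨hs₂, hd₂⟩ := key h₂ hy₂ heq.symm
  have := ODE_solution_unique_of_eventually (v := fun _ ↦ spray g y) (s := fun _ ↦ s)
    (Filter.Eventually.of_forall fun _ ↦ hK) hd₁ hd₂ heq
  filter_upwards [this, hs₁, hs₂] with τ h h1 h2
  exact (extChartAt 𝓘(ℝ, E) y).injOn (by simpa using h1) (by simpa using h2) (congrArg Prod.fst h)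

open Metric Set in
/-- The local geodesic flow in a chart, differentiable with respect to the initial condition. -/
theorem exists_local_geodesic_flow (g : Metric E M) {y : M} {z₀ : E × E}
    (hz₀ : z₀.1 ∈ (extChartAt 𝓘(ℝ, E) y).target) :
    ∃ r > 0, ∃ ε > 0, ∃ Ψ : E × E → ℝ → M, ∀ z ∈ ball z₀ r,
      state y (Ψ z) 0 = z ∧
      (∀ t ∈ Ioo (-ε) ε, Ψ z t ∈ (chartAt E y).source ∧ IsGeodesicAt g (Ψ z) t) ∧
      ∀ t ∈ Ico 0 ε, DifferentiableAt ℝ (fun z ↦ (state y (Ψ z) t : E × E)) z := by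
  obtain ⟨r, hr, ε, hε, Φ, hΦ⟩ := ((contDiffAt_spray g hz₀).of_le
    (WithTop.coe_le_coe.2 (le_top : (2 : ℕ∞) ≤ ⊤))).exists_localFlow_differentiableAt
    (s := Prod.fst ⁻¹' (extChartAt 𝓘(ℝ, E) y).target)
    (((isOpen_extChartAt_target y).preimage continuous_fst).mem_nhds hz₀)
  have key : ∀ z ∈ ball z₀ r, ∀ t ∈ Ioo (-ε) ε, _ := fun z hz t ht ↦
    isGeodesicAt_of_hasDerivAt_spray g isOpen_Ioo (fun τ hτ ↦ ((hΦ z hz).2.1 τ hτ).1)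
      (fun τ hτ ↦ ((hΦ z hz).2.1 τ hτ).2) ht
  refine ⟨r, hr, ε, hε, fun z t ↦ (extChartAt 𝓘(ℝ, E) y).symm (Φ z t).1, fun z hz ↦
    ⟨?_, fun t ht ↦ ⟨?_, (key z hz t ht).1⟩, fun t ht ↦ ?_⟩⟩
  · rw [(key z hz 0 ⟨by linarith, hε⟩).2, (hΦ z hz).1]
  · rw [← extChartAt_source 𝓘(ℝ, E)]
    exact PartialEquiv.map_target _ ((hΦ z hz).2.1 t ht).1
  · refine ((hΦ z hz).2.2 t ht).congr_of_eventuallyEq ?_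
    filter_upwards [isOpen_ball.mem_nhds hz] with z' hz'
    exact (key z' hz' t ⟨by linarith [ht.1], ht.2⟩).2

end RiemannianExp

/-! ### Global uniqueness, homogeneity and the radial derivative of exp -/

theorem eventually_ne_of_continuousAt {X Y : Type*} [TopologicalSpace X] [TopologicalSpace Y]
    [T2Space Y] {f g : X → Y} {x : X} (hf : ContinuousAt f x) (hg : ContinuousAt g x)
    (h : f x ≠ g x) : ∀ᶠ z in 𝓝 x, f z ≠ g z :=
  (hf.prodMk hg).eventually_mem (isClosed_diagonal.isOpen_compl.mem_nhds h)

namespace RiemannianExp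

open Set

variable {E : Type*} [NormedAddCommGroup E] [NormedSpace ℝ E]
  {M : Type*} [TopologicalSpace M] [ChartedSpace E M]

theorem state_fst_mem_target {y : M} {γ : ℝ → M} {t : ℝ} (hy : γ t ∈ (chartAt E y).source) :
    (state y γ t : E × E).1 ∈ (extChartAt 𝓘(ℝ, E) y).target :=
  PartialEquiv.map_source _ (by simpa using hy)

/-- The fibre at `γ t` is identified with `E` by the preferred chart at `γ t`, hence the choice of
that chart in `state`. -/
theorem mfderiv_curve_apply_one {γ : ℝ → M} {t : ℝ}
    (hγ : MDifferentiableAt 𝓘(ℝ, ℝ) 𝓘(ℝ, E) γ t) :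
    (mfderiv 𝓘(ℝ, ℝ) 𝓘(ℝ, E) γ t : ℝ → E) (1 : ℝ) = (state (γ t) γ t : E × E).2 := by
  simp [mfderiv, hγ, writtenInExtChartAt, Function.comp_def, state, chartAt_self_eq]
  rfl

theorem tangentMap_curve_eq_iff {γ : ℝ → M} {t : ℝ} {x : M} {v : E}
    (hγ : MDifferentiableAt 𝓘(ℝ, ℝ) 𝓘(ℝ, E) γ t) :
    tangentMap 𝓘(ℝ, ℝ) 𝓘(ℝ, E) γ ⟨t, (1 : ℝ)⟩ = (⟨x, v⟩ : TangentBundle 𝓘(ℝ, E) M) ↔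
      γ t = x ∧ (state x γ t : E × E).2 = v := by
  have h1 := mfderiv_curve_apply_one hγ
  have h2 : tangentMap 𝓘(ℝ, ℝ) 𝓘(ℝ, E) γ ⟨t, (1 : ℝ)⟩ =
      (⟨γ t, (state (γ t) γ t : E × E).2⟩ : TangentBundle 𝓘(ℝ, E) M) := by
    rw [← h1]; rfl
  rw [h2]
  constructor
  · intro h
    have hx : γ t = x := congrArg Bundle.TotalSpace.proj h
    subst hx
    exact ⟨rfl, eq_of_heq (Bundle.TotalSpace.mk.inj h).2⟩
  · rintro ⟨rfl, rfl⟩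
    rfl

/-- Differentiability at the parameter `v` of the position and velocity at time `t` of a family of
curves. -/
structure StateDifferentiableAt (Γ : E → ℝ → M) (v : E) (t : ℝ) : Prop where
  continuousAt : ContinuousAt (fun w ↦ Γ w t) v
  differentiableAt : ∀ y : M, Γ v t ∈ (chartAt E y).source →
    DifferentiableAt ℝ (fun w ↦ (state y (Γ w) t : E × E)) v

/-- Agreement is asked for germs in time because the state contains a time derivative. -/
theorem StateDifferentiableAt.congr {Γ Γ' : E → ℝ → M} {v : E} {t : ℝ}
    (h : StateDifferentiableAt Γ v t) (heq : ∀ᶠ w in 𝓝 v, Γ' w =ᶠ[𝓝 t] Γ w) :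
    StateDifferentiableAt Γ' v t := by
  refine ⟨h.continuousAt.congr ?_, fun y hy ↦ (h.differentiableAt y ?_).congr_of_eventuallyEq ?_⟩
  · filter_upwards [heq] with w hw using hw.eq_of_nhds.symm
  · rwa [← heq.self_of_nhds.eq_of_nhds]
  · filter_upwards [heq] with w hw using state_congr hw

variable [IsManifold 𝓘(ℝ, E) ∞ M]

/-- `γ` is a geodesic on the interval `(a, b)`, with position `x` and velocity `v` at time `0`. -/
structure IsGeodesicFrom (g : Metric E M) (x : M) (v : E) (a b : ℝ) (γ : ℝ → M) : Prop where
  isGeodesicAt : ∀ t ∈ Ioo a b, IsGeodesicAt g γ t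
  map_zero : γ 0 = x
  velocity_zero : (state x γ 0 : E × E).2 = v

theorem IsGeodesicFrom.state_zero {g : Metric E M} {x : M} {v : E} {a b : ℝ} {γ : ℝ → M}
    (h : IsGeodesicFrom g x v a b γ) : state x γ 0 = (extChartAt 𝓘(ℝ, E) x x, v) :=
  Prod.ext (by simp only [state, h.map_zero]) h.velocity_zero

theorem IsGeodesicFrom.mono {g : Metric E M} {x : M} {v : E} {a b a' b' : ℝ} {γ : ℝ → M}
    (h : IsGeodesicFrom g x v a b γ) (ha : a ≤ a') (hb : b' ≤ b) :
    IsGeodesicFrom g x v a' b' γ :=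
  ⟨fun t ht ↦ h.isGeodesicAt t ⟨ha.trans_lt ht.1, ht.2.trans_le hb⟩, h.map_zero, h.velocity_zero⟩

theorem isUnitGeodesicFrom_iff (g : Metric E M) (x : M) (v : E) (γ : ℝ → M) :
    IsUnitGeodesicFrom g x v γ ↔ ∃ a b : ℝ, a < 0 ∧ 1 < b ∧ IsGeodesicFrom g x v a b γ := by
  refine exists_congr fun a ↦ exists_congr fun b ↦ and_congr_right fun ha ↦
    and_congr_right fun hb ↦ ?_
  rw [isGeodesicOn_iff g γ isOpen_Ioo]
  have key : (∀ t ∈ Ioo a b, IsGeodesicAt g γ t) → MDifferentiableAt 𝓘(ℝ, ℝ) 𝓘(ℝ, E) γ 0 :=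
    fun h ↦ (h 0 ⟨ha, by linarith⟩).contMDiffAt.mdifferentiableAt (by simp)
  constructor
  · rintro ⟨h, h'⟩
    obtain ⟨h1, h2⟩ := (tangentMap_curve_eq_iff (key h)).1 h'
    exact ⟨h, h1, h2⟩
  · rintro ⟨h, h1, h2⟩
    exact ⟨h, (tangentMap_curve_eq_iff (key h)).2 ⟨h1, h2⟩⟩

theorem mem_expDomain_iff (g : Metric E M) (x : M) (v : E) :
    v ∈ expDomain g x ↔ ∃ γ a b, a < 0 ∧ 1 < b ∧ IsGeodesicFrom g x v a b γ :=
  exists_congr fun γ ↦ isUnitGeodesicFrom_iff g x v γ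

theorem IsGeodesicFrom.comp_mul {g : Metric E M} {x : M} {v : E} {a b : ℝ} {γ : ℝ → M}
    (h : IsGeodesicFrom g x v a b γ) {s : ℝ} {a' b' : ℝ}
    (hs : ∀ t ∈ Ioo a' b', s * t ∈ Ioo a b) :
    IsGeodesicFrom g x (s • v) a' b' (fun τ ↦ γ (s * τ)) := by
  refine ⟨fun t ht ↦ (h.isGeodesicAt _ (hs t ht)).comp_mul, ?_, ?_⟩
  · simpa using h.map_zero
  · rw [state_comp_mul, mul_zero, h.velocity_zero]

/-- The times `t` with `s * t ∈ Ioo a b` form an open convex set containing 0 and 1; this is the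
interval on which a geodesic rescaled by `s` lives. -/
theorem exists_Ioo_mul_mem {a b s : ℝ} (h0 : (0 : ℝ) ∈ Ioo a b) (hs : s ∈ Ioo a b) :
    ∃ a' b' : ℝ, a' < 0 ∧ 1 < b' ∧ ∀ t ∈ Ioo a' b', s * t ∈ Ioo a b := by
  have hopen : IsOpen ((fun t ↦ s * t) ⁻¹' Ioo a b) := isOpen_Ioo.preimage (by fun_prop)
  obtain ⟨δ₀, hδ₀, h₀⟩ := Metric.isOpen_iff.1 hopen 0 (by simpa using h0)
  obtain ⟨δ₁, hδ₁, h₁⟩ := Metric.isOpen_iff.1 hopen 1 (by simpa using hs)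
  refine ⟨-δ₀, 1 + δ₁, by linarith, by linarith, fun t ht ↦ ?_⟩
  rcases lt_or_ge t 0 with h | h
  · exact h₀ (by rw [Metric.mem_ball, Real.dist_eq, abs_lt]; constructor <;> linarith [ht.1])
  rcases lt_or_ge 1 t with h' | h'
  · exact h₁ (by rw [Metric.mem_ball, Real.dist_eq, abs_lt]; constructor <;> linarith [ht.2])
  have := (convex_Ioo a b) h0 hs (a := 1 - t) (b := t) (by linarith) h (by ring)
  simpa [mul_comm] using this

/-- One chart suffices, because the tangent map of a coordinate change is differentiable. -/
theorem StateDifferentiableAt.of_chart {Γ : E → ℝ → M} {v : E} {t : ℝ} {y : M}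
    (hsrc : ∀ᶠ w in 𝓝 v, Γ w t ∈ (chartAt E y).source)
    (hΓ : ∀ᶠ w in 𝓝 v, ContMDiffAt 𝓘(ℝ, ℝ) 𝓘(ℝ, E) 2 (Γ w) t)
    (hd : DifferentiableAt ℝ (fun w ↦ (state y (Γ w) t : E × E)) v) :
    StateDifferentiableAt Γ v t := by
  have hcont : ContinuousAt (fun w ↦ Γ w t) v := by
    have h1 : ContinuousAt (fun w ↦ (extChartAt 𝓘(ℝ, E) y).symm (state y (Γ w) t : E × E).1) v :=
      ContinuousAt.comp (g := (extChartAt 𝓘(ℝ, E) y).symm)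
        (contMDiffAt_extChartAt_symm (state_fst_mem_target hsrc.self_of_nhds)).continuousAt
        hd.continuousAt.fst
    refine h1.congr ?_
    filter_upwards [hsrc] with w hw
    exact PartialEquiv.left_inv _ (by simpa using hw)
  refine ⟨hcont, fun z hz ↦ ?_⟩
  have h1 : DifferentiableAt ℝ (fun w ↦ transitionState E y z (state y (Γ w) t)) v :=
    DifferentiableAt.comp v (g := transitionState E y z) (differentiableAt_transitionState
      (extChartAt_mem_overlap hsrc.self_of_nhds hz)) hd
  refine h1.congr_of_eventuallyEq ?_
  filter_upwards [hsrc, hΓ, hcont.eventually_mem ((chartAt E z).open_source.mem_nhds hz)]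
    with w hw1 hw2 hw3
  exact state_eq_transitionState hw2 hw1 hw3

variable [FiniteDimensional ℝ E]

/-- Two geodesics on an interval of a Hausdorff manifold agree if they have the same position and
velocity at some time. -/
theorem eqOn_of_state_eq [T2Space M] {g : Metric E M} {γ₁ γ₂ : ℝ → M} {a b t₀ : ℝ} {y : M}
    (h₁ : ∀ t ∈ Ioo a b, IsGeodesicAt g γ₁ t) (h₂ : ∀ t ∈ Ioo a b, IsGeodesicAt g γ₂ t)
    (ht₀ : t₀ ∈ Ioo a b) (hy₁ : γ₁ t₀ ∈ (chartAt E y).source)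
    (hy₂ : γ₂ t₀ ∈ (chartAt E y).source) (heq : (state y γ₁ t₀ : E × E) = state y γ₂ t₀) :
    EqOn γ₁ γ₂ (Ioo a b) := by
  have hev : ∀ {γ : ℝ → M}, (∀ t ∈ Ioo a b, IsGeodesicAt g γ t) → ∀ t ∈ Ioo a b,
      ∀ᶠ τ in 𝓝 t, IsGeodesicAt g γ τ := fun h t ht ↦ by
    filter_upwards [isOpen_Ioo.mem_nhds ht] with τ hτ using h τ hτ
  have h0 : γ₁ =ᶠ[𝓝 t₀] γ₂ :=
    eventuallyEq_of_state_eq (hev h₁ t₀ ht₀) (hev h₂ t₀ ht₀) hy₁ hy₂ heq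
  intro t ht
  -- Equality of germs is shown to be locally constant in time, hence constant on the connected
  -- interval.
  refine Filter.EventuallyEq.eq_of_nhds (x := t)
    (isPreconnected_Ioo.induction₂' (fun s t ↦ γ₁ =ᶠ[𝓝 s] γ₂ → γ₁ =ᶠ[𝓝 t] γ₂) ?_
      (fun _ _ _ _ _ _ h h' hs ↦ h' (h hs)) ht₀ ht h0)
  intro s hs
  refine nhdsWithin_le_nhds ?_
  by_cases hgerm : γ₁ =ᶠ[𝓝 s] γ₂
  · filter_upwards [eventually_eventually_nhds.2 hgerm] with τ hτ
    exact ⟨fun _ ↦ hτ, fun _ ↦ hgerm⟩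
  suffices h : ∀ᶠ τ in 𝓝 s, ¬ γ₁ =ᶠ[𝓝 τ] γ₂ by
    filter_upwards [h] with τ hτ
    exact ⟨fun h ↦ absurd h hgerm, fun h ↦ absurd h hτ⟩
  have hc₁ := (h₁ s hs).contMDiffAt.continuousAt
  have hc₂ := (h₂ s hs).contMDiffAt.continuousAt
  -- Disagreement of germs is open: over a common point local uniqueness makes the states differ,
  -- which persists by continuity; distinct points are separated by the Hausdorff property.
  by_cases hpt : γ₁ s = γ₂ s
  · have hs₁ : γ₁ s ∈ (chartAt E (γ₁ s)).source := mem_chart_source E _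
    have hs₂ : γ₂ s ∈ (chartAt E (γ₁ s)).source := hpt ▸ hs₁
    have hne : (state (γ₁ s) γ₁ s : E × E) ≠ state (γ₁ s) γ₂ s := fun h ↦
      hgerm (eventuallyEq_of_state_eq (hev h₁ s hs) (hev h₂ s hs) hs₁ hs₂ h)
    filter_upwards [eventually_ne_of_continuousAt ((h₁ s hs).hasDerivAt_state hs₁).continuousAt
      ((h₂ s hs).hasDerivAt_state hs₂).continuousAt hne] with τ hτ h
    exact hτ (state_congr h)
  · filter_upwards [eventually_ne_of_continuousAt hc₁ hc₂ hpt] with τ hτ h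
    exact hτ h.eq_of_nhds

theorem IsGeodesicFrom.eqOn [T2Space M] {g : Metric E M} {x : M} {v : E} {a b : ℝ} {γ₁ γ₂ : ℝ → M}
    (h₁ : IsGeodesicFrom g x v a b γ₁) (h₂ : IsGeodesicFrom g x v a b γ₂)
    (h0 : (0 : ℝ) ∈ Ioo a b) : EqOn γ₁ γ₂ (Ioo a b) :=
  eqOn_of_state_eq h₁.isGeodesicAt h₂.isGeodesicAt h0 (y := x)
    (by rw [h₁.map_zero]; exact mem_chart_source E x)
    (by rw [h₂.map_zero]; exact mem_chart_source E x) (h₁.state_zero.trans h₂.state_zero.symm)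

theorem expMap_eq [T2Space M] {g : Metric E M} {x : M} {v : E} {a b : ℝ} {γ : ℝ → M}
    (h : IsGeodesicFrom g x v a b γ) (ha : a < 0) (hb : 1 < b) : expMap g x v = γ 1 := by
  have hex : ∃ γ : ℝ → M, IsUnitGeodesicFrom g x v γ :=
    ⟨γ, (isUnitGeodesicFrom_iff g x v γ).2 ⟨a, b, ha, hb, h⟩⟩
  rw [show expMap g x v = hex.choose 1 from dif_pos hex]
  obtain ⟨a', b', ha', hb', h'⟩ := (isUnitGeodesicFrom_iff g x v _).1 hex.choose_spec
  have hb1 : 1 < min b b' := lt_min hb hb'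
  have ha0 : max a a' < 0 := max_lt ha ha'
  exact ((h'.mono (le_max_right a a') (min_le_right b b')).eqOn
    (h.mono (le_max_left _ _) (min_le_left _ _)) ⟨ha0, by linarith⟩) ⟨by linarith, hb1⟩

/-- The geodesic with initial velocity `s • v` is `γ` run at speed `s`, so its time 1 is time `s` of
`γ`. -/
theorem expMap_smul_eq [T2Space M] {g : Metric E M} {x : M} {v : E} {a b : ℝ} {γ : ℝ → M}
    (h : IsGeodesicFrom g x v a b γ) (h0 : (0 : ℝ) ∈ Ioo a b) {s : ℝ} (hs : s ∈ Ioo a b) :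
    expMap g x (s • v : E) = γ s := by
  obtain ⟨a', b', ha', hb', h'⟩ := exists_Ioo_mul_mem h0 hs
  rw [expMap_eq (h.comp_mul h') ha' hb', mul_one]

/-- A geodesic whose velocity vanishes at some time has zero initial velocity. -/
theorem IsGeodesicFrom.eq_zero_of_velocity_eq_zero [T2Space M] {g : Metric E M} {x : M} {v : E}
    {a b : ℝ} {γ : ℝ → M} (h : IsGeodesicFrom g x v a b γ) (h0 : (0 : ℝ) ∈ Ioo a b) {s : ℝ}
    (hs : s ∈ Ioo a b) (hv : (state (γ s) γ s : E × E).2 = 0) : v = 0 := by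
  -- With zero velocity at time `s`, the curve has the same state there as the constant geodesic.
  have heq : EqOn γ (fun _ ↦ γ s) (Ioo a b) :=
    eqOn_of_state_eq h.isGeodesicAt (fun t _ ↦ isGeodesicAt_const g (γ s) t) hs (y := γ s)
      (mem_chart_source E _) (mem_chart_source E _)
      (Prod.ext rfl (by rw [hv]; simp [state]))
  have hgerm : γ =ᶠ[𝓝 0] fun _ ↦ γ s := by
    filter_upwards [isOpen_Ioo.mem_nhds h0] with τ hτ using heq hτ
  rw [← h.velocity_zero, state_congr hgerm]
  simp [state]

/-- The differential of the exponential map at a point of a ray does not vanish on the direction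
of the ray. -/
theorem mfderiv_expMap_smul_ne_zero [T2Space M] {g : Metric E M} {x : M} {v : E}
    {a b : ℝ} {γ : ℝ → M} (h : IsGeodesicFrom g x v a b γ) (h0 : (0 : ℝ) ∈ Ioo a b) {s : ℝ}
    (hs : s ∈ Ioo a b) (hv : v ≠ 0)
    (hd : MDifferentiableAt 𝓘(ℝ, E) 𝓘(ℝ, E) (fun w : E ↦ expMap g x w) (s • v)) :
    mfderiv 𝓘(ℝ, E) 𝓘(ℝ, E) (fun w : E ↦ expMap g x w) (s • v) v ≠ 0 := by
  intro hzero
  have hray : HasMFDerivAt 𝓘(ℝ, ℝ) 𝓘(ℝ, E) (fun τ : ℝ ↦ τ • v) s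
      (ContinuousLinearMap.toSpanSingleton ℝ v) :=
    ((ContinuousLinearMap.toSpanSingleton ℝ v).hasFDerivAt (x := s)).hasMFDerivAt
  -- Along the ray exp is `γ` itself, so the chain rule identifies the image of `v` with the
  -- velocity of `γ` at `s`.
  have hγ : (fun τ : ℝ ↦ expMap g x (τ • v : E)) =ᶠ[𝓝 s] γ := by
    filter_upwards [isOpen_Ioo.mem_nhds hs] with τ hτ using expMap_smul_eq h h0 hτ
  have hcomp := (HasMFDerivAt.comp (g := fun w : E ↦ expMap g x w) s hd.hasMFDerivAt
    hray).congr_of_eventuallyEq hγ.symm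
  refine hv (h.eq_zero_of_velocity_eq_zero h0 hs ?_)
  rw [← mfderiv_curve_apply_one hcomp.mdifferentiableAt, hcomp.mfderiv]
  change mfderiv 𝓘(ℝ, E) 𝓘(ℝ, E) (fun w : E ↦ expMap g x w) (s • v) ((1 : ℝ) • v) = 0
  rw [one_smul]
  exact hzero

end RiemannianExp

/-! ### Continuation of geodesic families; openness and differentiability -/

namespace RiemannianExp

open Set

variable {E : Type*} [NormedAddCommGroup E] [NormedSpace ℝ E] [FiniteDimensional ℝ E]
  {M : Type*} [TopologicalSpace M] [ChartedSpace E M] [IsManifold 𝓘(ℝ, E) ∞ M]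

/-- Near the initial velocity `v`, geodesics from `x` exist beyond the time `T`, in a family whose
position and velocity at each time of `[0, T]` are differentiable at `v`. -/
def HasGeodesicFamily (g : Metric E M) (x : M) (v : E) (T : ℝ) : Prop :=
  ∃ Γ : E → ℝ → M, (∃ a < 0, ∃ b > T, ∀ᶠ w in 𝓝 v, IsGeodesicFrom g x w a b (Γ w)) ∧
    ∀ t ∈ Icc 0 T, StateDifferentiableAt Γ v t

theorem hasGeodesicFamily_zero (g : Metric E M) (x : M) (v : E) :
    HasGeodesicFamily g x v 0 := by
  obtain ⟨r, hr, ε, hε, Ψ, hΨ⟩ := exists_local_geodesic_flow g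
    (z₀ := (extChartAt 𝓘(ℝ, E) x x, v)) (mem_extChartAt_target x)
  have hι : Differentiable ℝ fun w : E ↦ (extChartAt 𝓘(ℝ, E) x x, w) := by fun_prop
  have hball : ∀ᶠ w in 𝓝 v, (extChartAt 𝓘(ℝ, E) x x, w) ∈
      Metric.ball (extChartAt 𝓘(ℝ, E) x x, v) r :=
    hι.continuous.continuousAt.eventually_mem (Metric.ball_mem_nhds _ hr)
  have h0 : (0 : ℝ) ∈ Ioo (-ε) ε := ⟨by linarith, hε⟩
  refine ⟨fun w ↦ Ψ (extChartAt 𝓘(ℝ, E) x x, w), ⟨-ε, by linarith, ε, hε, ?_⟩, fun t ht ↦ ?_⟩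
  · filter_upwards [hball] with w hw
    obtain ⟨h1, h2, -⟩ := hΨ _ hw
    refine ⟨fun t ht ↦ (h2 t ht).2, ?_, congrArg Prod.snd h1⟩
    exact (extChartAt 𝓘(ℝ, E) x).injOn (by simpa using (h2 0 h0).1) (mem_extChartAt_source x)
      (congrArg Prod.fst h1)
  · obtain rfl : t = 0 := le_antisymm ht.2 ht.1
    refine StateDifferentiableAt.of_chart (y := x) ?_ ?_ ?_
    · filter_upwards [hball] with w hw using ((hΨ _ hw).2.1 0 h0).1
    · filter_upwards [hball] with w hw using ((hΨ _ hw).2.1 0 h0).2.contMDiffAt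
    · exact DifferentiableAt.comp v (g := fun z ↦ (state x (Ψ z) 0 : E × E))
        ((hΨ _ hball.self_of_nhds).2.2 0 ⟨le_rfl, hε⟩) hι.differentiableAt

/-- A family of geodesics that exists up to the time `T₁` is continued by the local geodesic flow
around its position and velocity at that time. -/
theorem HasGeodesicFamily.extend {g : Metric E M} {x : M} {v : E} {T₁ T₂ : ℝ} (hT₁ : 0 ≤ T₁)
    {y : M} {r ε : ℝ} {z₀ : E × E} {Ψ : E × E → ℝ → M}
    (hΨ : ∀ z ∈ Metric.ball z₀ r, state y (Ψ z) 0 = z ∧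
      (∀ t ∈ Ioo (-ε) ε, Ψ z t ∈ (chartAt E y).source ∧ IsGeodesicAt g (Ψ z) t) ∧
      ∀ t ∈ Ico 0 ε, DifferentiableAt ℝ (fun z ↦ (state y (Ψ z) t : E × E)) z)
    (hT₂ : T₂ < T₁ + ε) (hε : 0 < ε) {Γ : E → ℝ → M} {a b : ℝ} (ha : a < 0) (hb : T₁ < b)
    (hΓ : ∀ᶠ w in 𝓝 v, IsGeodesicFrom g x w a b (Γ w))
    (hΓd : ∀ t ∈ Icc 0 T₁, StateDifferentiableAt Γ v t)
    (hy : Γ v T₁ ∈ (chartAt E y).source) (hz : state y (Γ v) T₁ ∈ Metric.ball z₀ r) :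
    HasGeodesicFamily g x v T₂ := by
  have hT₁d := hΓd T₁ ⟨hT₁, le_rfl⟩
  have hzd := hT₁d.differentiableAt y hy
  -- Each geodesic is restarted at time `T₁` from its state there, with the clock of the local flow
  -- shifted by `T₁`.
  let ψ : E → ℝ → M := fun w τ ↦ Ψ (state y (Γ w) T₁) (τ - T₁)
  let Γ' : E → ℝ → M := fun w τ ↦ if τ < T₁ then Γ w τ else ψ w τ
  have hball : ∀ᶠ w in 𝓝 v, state y (Γ w) T₁ ∈ Metric.ball z₀ r :=
    hzd.continuousAt.eventually_mem (Metric.isOpen_ball.mem_nhds hz)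
  have hψg : ∀ᶠ w in 𝓝 v, ∀ t ∈ Ioo (T₁ - ε) (T₁ + ε),
      ψ w t ∈ (chartAt E y).source ∧ IsGeodesicAt g (ψ w) t := by
    filter_upwards [hball] with w hw t ht
    have := (hΨ _ hw).2.1 (t - T₁) ⟨by linarith [ht.1], by linarith [ht.2]⟩
    exact ⟨this.1, this.2.comp_sub⟩
  -- Local uniqueness makes the two branches agree on a whole neighbourhood of `T₁`, so the
  -- piecewise curve has no kink.
  have hglue : ∀ᶠ w in 𝓝 v, Γ w =ᶠ[𝓝 T₁] ψ w := by
    filter_upwards [hball, hψg, hΓ,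
      hT₁d.continuousAt.eventually_mem ((chartAt E y).open_source.mem_nhds hy)] with w h1 h2 h3 h4
    have hI : Ioo (T₁ - ε) (T₁ + ε) ∈ 𝓝 T₁ := Ioo_mem_nhds (by linarith) (by linarith)
    refine eventuallyEq_of_state_eq (g := g) (y := y) ?_ ?_ h4 (h2 T₁ (mem_of_mem_nhds hI)).1 ?_
    · filter_upwards [Ioo_mem_nhds (ha.trans_le hT₁) hb] with τ hτ using h3.isGeodesicAt τ hτ
    · filter_upwards [hI] with τ hτ using (h2 τ hτ).2
    · rw [state_comp_sub, sub_self, (hΨ _ h1).1]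
  have hleft : ∀ᶠ w in 𝓝 v, ∀ t ≤ T₁, Γ' w =ᶠ[𝓝 t] Γ w := by
    filter_upwards [hglue] with w hw t ht
    rcases ht.lt_or_eq with h | rfl
    · filter_upwards [Iio_mem_nhds h] with τ hτ using if_pos hτ
    · filter_upwards [hw] with τ hτ
      by_cases h : τ < t
      · exact if_pos h
      · exact (if_neg h).trans hτ.symm
  have hright : ∀ w, ∀ t > T₁, Γ' w =ᶠ[𝓝 t] ψ w := fun w t ht ↦ by
    filter_upwards [Ioi_mem_nhds ht] with τ hτ using if_neg (not_lt.2 (le_of_lt hτ))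
  refine ⟨Γ', ⟨a, ha, T₁ + ε, hT₂, ?_⟩, fun t ht ↦ ?_⟩
  · filter_upwards [hleft, hψg, hΓ] with w h1 h2 h3
    refine ⟨fun t ht ↦ ?_, ?_, ?_⟩
    · rcases le_or_gt t T₁ with h | h
      · exact (h3.isGeodesicAt t ⟨ht.1, h.trans_lt hb⟩).congr (h1 t h)
      · exact (h2 t ⟨by linarith, ht.2⟩).2.congr (hright w t h)
    · rw [(h1 0 hT₁).eq_of_nhds, h3.map_zero]
    · rw [state_congr (h1 0 hT₁), h3.velocity_zero]
  · rcases le_or_gt t T₁ with h | h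
    · refine (hΓd t ⟨ht.1, h⟩).congr ?_
      filter_upwards [hleft] with w hw using hw t h
    · have htI : t ∈ Ioo (T₁ - ε) (T₁ + ε) := ⟨by linarith, ht.2.trans_lt hT₂⟩
      refine StateDifferentiableAt.congr (Γ := ψ) ?_ (.of_forall fun w ↦ hright w t h)
      refine StateDifferentiableAt.of_chart (y := y) ?_ ?_ ?_
      · filter_upwards [hψg] with w hw using (hw t htI).1
      · filter_upwards [hψg] with w hw using (hw t htI).2.contMDiffAt
      -- Past `T₁` the state is the flow after the nonnegative time `t - T₁`, composed with the
      -- differentiable state at `T₁`.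
      · simp only [ψ, state_comp_sub]
        exact DifferentiableAt.comp v (g := fun z ↦ (state y (Ψ z) (t - T₁) : E × E))
          ((hΨ _ hz).2.2 (t - T₁) ⟨by linarith, by linarith [htI.2]⟩) hzd

/-- If the geodesic with initial velocity `v` exists up to the time `1`, then so do the geodesics
with nearby initial velocities. -/
theorem IsGeodesicFrom.hasGeodesicFamily_one [T2Space M] {g : Metric E M} {x : M} {v : E}
    {a b : ℝ} {γ : ℝ → M} (h : IsGeodesicFrom g x v a b γ) (ha : a < 0) (hb : 1 < b) :
    HasGeodesicFamily g x v 1 := by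
  -- Connectedness of [0, 1] reduces the claim to passing, near each `T`, from `T` to `s` and from
  -- `s` to `T`.
  refine isPreconnected_Icc.induction₂' (s := Icc (0 : ℝ) 1)
    (fun s t ↦ HasGeodesicFamily g x v s → HasGeodesicFamily g x v t) ?_
    (fun _ _ _ _ _ _ h h' hs ↦ h' (h hs)) (left_mem_Icc.2 zero_le_one)
    (right_mem_Icc.2 zero_le_one) (hasGeodesicFamily_zero g x v)
  intro T hT
  have hTab : T ∈ Ioo a b := ⟨ha.trans_le hT.1, hT.2.trans_lt hb⟩
  have hsrc : γ T ∈ (chartAt E (γ T)).source := mem_chart_source E _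
  obtain ⟨r, hr, ε, hε, Ψ, hΨ⟩ := exists_local_geodesic_flow g (state_fst_mem_target hsrc)
  have hgood : ∀ᶠ s in 𝓝 T, γ s ∈ (chartAt E (γ T)).source ∧
      state (γ T) γ s ∈ Metric.ball (state (γ T) γ T : E × E) r :=
    ((h.isGeodesicAt T hTab).contMDiffAt.continuousAt.eventually_mem
      ((chartAt E (γ T)).open_source.mem_nhds hsrc)).and
      (((h.isGeodesicAt T hTab).hasDerivAt_state hsrc).continuousAt.eventually_mem
        (Metric.ball_mem_nhds _ hr))
  -- The radius `r` and duration `ε` found at `T` serve every nearby `s`, which is what permits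
  -- steps in both directions.
  have hstep : ∀ s ∈ Icc (0 : ℝ) 1, ∀ t < s + ε, γ s ∈ (chartAt E (γ T)).source →
      state (γ T) γ s ∈ Metric.ball (state (γ T) γ T : E × E) r →
      HasGeodesicFamily g x v s → HasGeodesicFamily g x v t := by
    rintro s hs t hst hs1 hs2 ⟨Γ, ⟨a', ha', b', hb', hΓ⟩, hΓd⟩
    have hmem : s ∈ Ioo (max a a') (min b b') :=
      ⟨(max_lt ha ha').trans_le hs.1, lt_min (hs.2.trans_lt hb) hb'⟩
    -- Uniqueness identifies the member of the family at `v` with `γ`, placing its state at `s` in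
    -- the ball where the local flow exists.
    have heq : EqOn (Γ v) γ (Ioo (max a a') (min b b')) :=
      (hΓ.self_of_nhds.mono (le_max_right _ _) (min_le_right _ _)).eqOn
        (h.mono (le_max_left _ _) (min_le_left _ _)) ⟨max_lt ha ha', hs.1.trans_lt hmem.2⟩
    have hgerm : Γ v =ᶠ[𝓝 s] γ := by
      filter_upwards [isOpen_Ioo.mem_nhds hmem] with τ hτ using heq hτ
    refine HasGeodesicFamily.extend hs.1 hΨ hst hε ha' hb' hΓ hΓd ?_ ?_
    · rwa [hgerm.eq_of_nhds]
    · rwa [state_congr hgerm]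
  filter_upwards [nhdsWithin_le_nhds hgood, self_mem_nhdsWithin, nhdsWithin_le_nhds
    (Ioo_mem_nhds (show T - ε < T by linarith) (show T < T + ε by linarith))] with s hs hs01 hsI
  exact ⟨hstep T hT s hsI.2 hsrc (Metric.mem_ball_self hr),
    hstep s hs01 T (by linarith [hsI.1]) hs.1 hs.2⟩

theorem isOpen_expDomain [T2Space M] (g : Metric E M) (x : M) : IsOpen (expDomain g x) := by
  change IsOpen (X := E) {v : E | v ∈ expDomain g x}
  rw [isOpen_iff_mem_nhds]
  intro v hv
  obtain ⟨γ, a, b, ha, hb, h⟩ := (mem_expDomain_iff g x v).1 hv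
  obtain ⟨Γ, ⟨a', ha', b', hb', hΓ⟩, -⟩ := h.hasGeodesicFamily_one ha hb
  filter_upwards [hΓ] with w hw
  exact (mem_expDomain_iff g x w).2 ⟨Γ w, a', b', ha', hb', hw⟩

theorem mdifferentiableAt_expMap [T2Space M] (g : Metric E M) (x : M) {v : E}
    (hv : v ∈ expDomain g x) :
    MDifferentiableAt 𝓘(ℝ, E) 𝓘(ℝ, E) (fun w : E ↦ expMap g x w) v := by
  obtain ⟨γ, a, b, ha, hb, h⟩ := (mem_expDomain_iff g x v).1 hv
  obtain ⟨Γ, ⟨a', ha', b', hb', hΓ⟩, hΓd⟩ := h.hasGeodesicFamily_one ha hb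
  have h1 := hΓd 1 ⟨zero_le_one, le_rfl⟩
  have heq : (fun w : E ↦ expMap g x w) =ᶠ[𝓝 v] fun w ↦ Γ w 1 := by
    filter_upwards [hΓ] with w hw using expMap_eq hw ha' hb'
  refine MDifferentiableAt.congr_of_eventuallyEq ?_ heq
  rw [mdifferentiableAt_iff]
  refine ⟨h1.continuousAt, ?_⟩
  have h2 := (h1.differentiableAt (Γ v 1) (mem_chart_source E _)).fst
  simpa [writtenInExtChartAt, Function.comp_def, state, chartAt_self_eq,
    differentiableWithinAt_univ] using h2

end RiemannianExp

/-! ### The main theorem -/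

theorem mainTheorem5
    {E : Type*} [NormedAddCommGroup E] [NormedSpace ℝ E] [FiniteDimensional ℝ E]
    (hdim : 0 < Module.finrank ℝ E)
    {M : Type*} [TopologicalSpace M] [T2Space M] [ChartedSpace E M] [IsManifold 𝓘(ℝ, E) ∞ M]
    (g : RiemannianExp.Metric E M) (x : M) :
    IsOpen (RiemannianExp.expDomain g x) ∧
    ∀ v : E, v ∈ RiemannianExp.expDomain g x →
      MDifferentiableAt 𝓘(ℝ, E) 𝓘(ℝ, E) (fun w : E ↦ RiemannianExp.expMap g x w) v ∧
      Module.finrank ℝ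
          (LinearMap.ker
            (mfderiv 𝓘(ℝ, E) 𝓘(ℝ, E) (fun w : E ↦ RiemannianExp.expMap g x w) v).toLinearMap)
        < Module.finrank ℝ E := by
  refine ⟨RiemannianExp.isOpen_expDomain g x, fun v hv ↦ ?_⟩
  have hd := RiemannianExp.mdifferentiableAt_expMap g x hv
  refine ⟨hd, ?_⟩
  suffices h : ∃ u : E,
      mfderiv 𝓘(ℝ, E) 𝓘(ℝ, E) (fun w : E ↦ RiemannianExp.expMap g x w) v u ≠ 0 by
    obtain ⟨u, hu⟩ := h
    refine Submodule.finrank_lt (K := ℝ) (V := E) fun htop ↦ hu ?_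
    have : u ∈ (⊤ : Submodule ℝ E) := trivial
    rw [← htop] at this
    exact this
  by_cases hv0 : v = 0
  · subst hv0
    have : Nontrivial E := Module.finrank_pos_iff.1 hdim
    obtain ⟨u₀, hu₀⟩ := exists_ne (0 : E)
    have hopen : IsOpen (X := E) (RiemannianExp.expDomain g x) :=
      RiemannianExp.isOpen_expDomain g x
    have hcont : Continuous fun c : ℝ ↦ c • u₀ := by fun_prop
    -- At the origin `v` itself carries no information. Openness of the domain provides a nonzero `c
    -- • u₀` in it, and its ray is differentiated at `s = 0`.
    have hev : ∀ᶠ c in 𝓝[≠] (0 : ℝ), c • u₀ ∈ (RiemannianExp.expDomain g x : Set E) :=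
      nhdsWithin_le_nhds (hcont.continuousAt.eventually_mem
        (hopen.mem_nhds (by rw [zero_smul]; exact hv)))
    obtain ⟨c, hc, hc0⟩ := (hev.and self_mem_nhdsWithin).exists
    obtain ⟨γ, a, b, ha, hb, h⟩ := (RiemannianExp.mem_expDomain_iff g x (c • u₀)).1 hc
    have h0 : (0 : ℝ) ∈ Set.Ioo a b := ⟨ha, by linarith⟩
    have := RiemannianExp.mfderiv_expMap_smul_ne_zero h h0 h0 (smul_ne_zero hc0 hu₀)
      (by simpa using hd)
    rw [zero_smul] at this
    exact ⟨_, this⟩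
  · obtain ⟨γ, a, b, ha, hb, h⟩ := (RiemannianExp.mem_expDomain_iff g x v).1 hv
    have := RiemannianExp.mfderiv_expMap_smul_ne_zero h ⟨ha, by linarith⟩
      (show (1 : ℝ) ∈ Set.Ioo a b from ⟨by linarith, hb⟩) hv0 (by simpa using hd)
    rw [one_smul] at this
    exact ⟨v, this⟩
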